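/- Let $G = N \rtimes H$ be a discrete semidirect product group with normal subgroup $N$ and quotient group $H$, and let $M \neq \{e\}$ be a normal subgroup of $N$. Put $\mathcal U = \{aMa^{-1} : a \in H\}$ and assume: - for all $U, V \in \mathcal U$ there is $W \in \mathcal U$ with $W \subseteq U \cap V$, and $\bigcap_{U \in \mathcal U} U = \{e\}$; - $|U/V| < \infty$ whenever $U, V \in \mathcal U$ and $V \subseteq U$; - $H$ is abelian, and $N = \bigcup_{a \in H^+} a^{-1} M a$, where $H^+ = \{a \in H : aMa^{-1} \subseteq M\}$. Let $D \subseteq \ell^\infty(N)$ be the $C^*$-subalgebra generated by the characteristic functions $\chi_{n hMh^{-1}}$ ($n \in N$, $h \in H$), let $H$ act on $D$ by $\alpha_h(f)(n) = f(h^{-1} n h)$, let $C = D \rtimes_\alpha H$ be the full $C^*$-crossed product, and let $p = \chi_M$, regarded as a projection in $C$. Then $pCp$ is a $C^*$-algebra with unit $p$. An *SP-family* in a unital $C^*$-algebra $B$ consists of isometries $S_a \in B$ ($a \in H^+$) and projections $P(a,m) \in B$ ($a \in H^+$, $m \in M$) such that, for all $a, b \in H^+$ and $m, k \in M$, $$S_a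 S_b = S_{ab}, \qquad P(e,e) = 1, \qquad S_a P(b,m) S_a^* = P(ab, ama^{-1}),$$ $$P(a,k) = \sum_{m bMb^{-1} \in M/bMb^{-1}} P(ab, kama^{-1}),$$ where the last relation is required for every choice of representatives $m$ of the cosets of $bMb^{-1}$ in $M$. **Theorem.** The elements $s_a = pap$ and $p(a,m) = \chi_{m aMa^{-1}}$ ($a \in H^+$, $m \in M$) form an SP-family in $pCp$, and this SP-family is universal: for every SP-family $\{S_a, P(a,m)\}$ in a unital $C^*$-algebra $B$ there is a unique $*$-homomorphism $\Pi : pCp \to B$ such that $$\Pi(s_a) = S_a \quad (a \in H^+), \qquad \Pi(p(a,m)) = P(a,m) \quad (a \in H^+,\ m \in M).$$ -/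

import Mathlib

/-! ### Completion of a C*-seminormed `*`-algebra -/

namespace CStarCompletion

set_option linter.unusedSectionVars false

open UniformSpace UniformSpace.Completion

variable {E : Type*} [NonUnitalSeminormedRing E]

noncomputable abbrev instMul : Mul (Completion E) :=
  ⟨Function.curry <| (isDenseInducing_coe.prodMap isDenseInducing_coe).extend
    ((↑) ∘ Function.uncurry (· * · : E → E → E))⟩

attribute [local instance] instMul

theorem coe_mul (a b : E) : ((a * b : E) : Completion E) = a * b :=
  ((isDenseInducing_coe.prodMap isDenseInducing_coe).extend_eq
      ((continuous_coe E).comp (@continuous_mul E _ _ _)) (a, b)).symm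

theorem continuousMul : ContinuousMul (Completion E) where
  continuous_mul := by
    let m := (AddMonoidHom.mul : E →+ E →+ E).compr₂ toCompl
    have : Continuous fun p : E × E => m p.1 p.2 := (continuous_coe E).comp continuous_mul
    have di : IsDenseInducing (toCompl : E → Completion E) := isDenseInducing_coe
    exact (di.extend_Z_bilin di this :)

attribute [local instance] continuousMul

noncomputable abbrev nonUnitalNormedRing : NonUnitalNormedRing (Completion E) :=
  { (inferInstance : NormedAddCommGroup (Completion E)),
    (inferInstance : Mul (Completion E)) with
    zero_mul := fun a =>
      Completion.induction_on a (isClosed_eq (by fun_prop) continuous_const)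
        fun a => by rw [← coe_zero, ← coe_mul, zero_mul]
    mul_zero := fun a =>
      Completion.induction_on a (isClosed_eq (by fun_prop) continuous_const)
        fun a ↦ by rw [← coe_zero, ← coe_mul, mul_zero]
    mul_assoc := fun a b c =>
      Completion.induction_on₃ a b c
        (isClosed_eq (by fun_prop) (by fun_prop))
        fun a b c => by rw [← coe_mul, ← coe_mul, ← coe_mul, ← coe_mul, mul_assoc]
    left_distrib := fun a b c =>
      Completion.induction_on₃ a b c
        (isClosed_eq (by fun_prop) (by fun_prop))
        fun a b c => by rw [← coe_add, ← coe_mul, ← coe_mul, ← coe_mul, ← coe_add, mul_add]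
    right_distrib := fun a b c =>
      Completion.induction_on₃ a b c
        (isClosed_eq (by fun_prop) (by fun_prop))
        fun a b c => by rw [← coe_add, ← coe_mul, ← coe_mul, ← coe_mul, ← coe_add, add_mul]
    norm_mul_le := fun a b =>
      Completion.induction_on₂ a b (isClosed_le (by fun_prop) (by fun_prop))
        fun a b => by rw [← coe_mul, norm_coe, norm_coe, norm_coe]; exact norm_mul_le a b }

attribute [local instance] nonUnitalNormedRing

variable [StarRing E]

noncomputable abbrev instStar : Star (Completion E) := ⟨Completion.map star⟩

attribute [local instance] instStar

theorem coe_star [NormedStarGroup E] (a : E) : ((star a : E) : Completion E) = star (a : Completion E) :=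
  (Completion.map_coe (star_isometry (E := E)).uniformContinuous a).symm

theorem continuous_star_completion : Continuous (star : Completion E → Completion E) :=
  Completion.continuous_map

variable [NormedStarGroup E]

noncomputable abbrev starRing : StarRing (Completion E) where
  star_involutive a :=
    Completion.induction_on a
      (isClosed_eq (continuous_star_completion.comp continuous_star_completion) continuous_id)
      fun a => by rw [← coe_star, ← coe_star, star_star]
  star_mul a b :=
    Completion.induction_on₂ a b
      (isClosed_eq (continuous_star_completion.comp continuous_mul)
        ((continuous_star_completion.comp continuous_snd).mul (continuous_star_completion.comp continuous_fst)))
      fun a b => by rw [← coe_mul, ← coe_star, ← coe_star, ← coe_star, ← coe_mul, star_mul]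
  star_add a b :=
    Completion.induction_on₂ a b
      (isClosed_eq (continuous_star_completion.comp continuous_add)
        ((continuous_star_completion.comp continuous_fst).add (continuous_star_completion.comp continuous_snd)))
      fun a b => by rw [← coe_add, ← coe_star, ← coe_star, ← coe_star, ← coe_add, star_add]

attribute [local instance] starRing

variable [NormedSpace ℂ E] [IsScalarTower ℂ E E] [SMulCommClass ℂ E E] [StarModule ℂ E]

theorem smul_mul_completion (c : ℂ) (a b : Completion E) : (c • a) * b = c • (a * b) :=
  Completion.induction_on₂ a b
    (isClosed_eq ((continuous_fst.const_smul c).mul continuous_snd)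
      ((continuous_fst.mul continuous_snd).const_smul c))
    fun a b => by rw [← coe_smul, ← coe_mul, ← coe_mul, ← coe_smul, smul_mul_assoc]

theorem mul_smul_completion (c : ℂ) (a b : Completion E) : a * (c • b) = c • (a * b) :=
  Completion.induction_on₂ a b
    (isClosed_eq (continuous_fst.mul (continuous_snd.const_smul c))
      ((continuous_fst.mul continuous_snd).const_smul c))
    fun a b => by rw [← coe_smul, ← coe_mul, ← coe_mul, ← coe_smul, mul_smul_comm]

theorem star_smul_completion (c : ℂ) (a : Completion E) : star (c • a) = star c • star a :=
  Completion.induction_on a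
    (isClosed_eq (continuous_star_completion.comp (continuous_const_smul c))
      ((continuous_const_smul (star c)).comp continuous_star_completion))
    fun a => by rw [← coe_smul, ← coe_star, ← coe_star, ← coe_smul, star_smul]

theorem norm_mul_self_le_completion (hE : ∀ a : E, ‖a‖ * ‖a‖ ≤ ‖star a * a‖)
    (a : Completion E) : ‖a‖ * ‖a‖ ≤ ‖star a * a‖ :=
  Completion.induction_on a
    (isClosed_le (continuous_norm.mul continuous_norm)
      ((continuous_star_completion.mul continuous_id).norm))
    fun a => by rw [← coe_star, ← coe_mul, norm_coe, norm_coe]; exact hE a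

/-- The Hausdorff completion of a `*`-algebra with respect to a C*-seminorm is a C*-algebra. -/
noncomputable abbrev nonUnitalCStarAlgebra (hE : ∀ a : E, ‖a‖ * ‖a‖ ≤ ‖star a * a‖) :
    NonUnitalCStarAlgebra (Completion E) :=
  { nonUnitalNormedRing (E := E), starRing (E := E),
    (inferInstance : NormedSpace ℂ (Completion E)) with
    complete := fun h => CompleteSpace.complete h
    norm_mul_self_le := norm_mul_self_le_completion hE
    smul_assoc := smul_mul_completion
    smul_comm := fun c a b => (mul_smul_completion c a b).symm
    star_smul := star_smul_completion }

end CStarCompletion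

/-! ### The full crossed product of a C*-algebra by a discrete group -/

section FullCrossedProduct

variable {H A : Type*} [Group H] [NonUnitalCStarAlgebra A]

/-- The `*`-algebra `C_c(H, A)` of finitely supported functions from the discrete group `H` to `A`,
for an action `α` of `H` on `A` by `*`-automorphisms. (The maps `α h` are automatically bijective,
as `α` is multiplicative and `H` is a group.) -/
def ConvAlgebra (_α : H →* (A →⋆ₙₐ[ℂ] A)) := H →₀ A

namespace ConvAlgebra

variable (α : H →* (A →⋆ₙₐ[ℂ] A))

noncomputable instance : AddCommGroup (ConvAlgebra α) := inferInstanceAs (AddCommGroup (H →₀ A))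

noncomputable instance : Module ℂ (ConvAlgebra α) := inferInstanceAs (Module ℂ (H →₀ A))

/-- The element of `C_c(H, A)` with value `a` at `h` and `0` elsewhere. In the crossed product it
becomes the element `i_A(a) i_H(h)`. -/
noncomputable def single (h : H) (a : A) : ConvAlgebra α := Finsupp.single h a

variable {α}

/-- The `ℓ¹`-norm `∑ h, ‖f h‖`. -/
noncomputable def l1Norm (f : ConvAlgebra α) : ℝ := Finsupp.sum f fun _ a => ‖a‖

/-- Twisted convolution, determined by `(a h) (b k) = a α_h(b) hk`. -/
noncomputable instance : Mul (ConvAlgebra α) :=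
  ⟨fun f g => Finsupp.sum f fun h a => Finsupp.sum g fun k b => single α (h * k) (a * α h b)⟩

/-- The involution, determined by `(a h)^* = α_{h⁻¹}(a^*) h⁻¹`. -/
noncomputable instance : Star (ConvAlgebra α) :=
  ⟨fun f => Finsupp.sum f fun h a => single α h⁻¹ (α h⁻¹ (star a))⟩

theorem induction {p : ConvAlgebra α → Prop} (f : ConvAlgebra α) (zero : p 0)
    (add : ∀ f g, p f → p g → p (f + g)) (single : ∀ h a, p (single α h a)) : p f :=
  Finsupp.induction_linear f zero add single

theorem single_zero (h : H) : single α h (0 : A) = 0 := Finsupp.single_zero h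

theorem single_add (h : H) (a b : A) : single α h (a + b) = single α h a + single α h b :=
  Finsupp.single_add h a b

theorem smul_single (c : ℂ) (h : H) (a : A) : c • single α h a = single α h (c • a) :=
  Finsupp.smul_single c h a

theorem act_mul (h k : H) (a : A) : α (h * k) a = α h (α k a) := by
  rw [map_mul]; rfl

theorem act_inv_act (h : H) (a : A) : α h⁻¹ (α h a) = a := by
  rw [← act_mul, inv_mul_cancel, map_one]; rfl

theorem zero_mul' (g : ConvAlgebra α) : 0 * g = 0 := Finsupp.sum_zero_index

theorem add_mul' (f f' g : ConvAlgebra α) : (f + f') * g = f * g + f' * g := by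
  refine Finsupp.sum_add_index' (fun h => ?_) (fun h a b => ?_)
  · simp only [zero_mul, single_zero]
    exact Finset.sum_const_zero
  · simp only [add_mul, single_add]
    exact Finset.sum_add_distrib

theorem mul_zero' (f : ConvAlgebra α) : f * 0 = 0 := by
  refine (Finset.sum_congr rfl fun h _ => ?_).trans Finset.sum_const_zero
  exact Finsupp.sum_zero_index

theorem mul_add' (f g g' : ConvAlgebra α) : f * (g + g') = f * g + f * g' := by
  refine (Finset.sum_congr rfl fun h _ => ?_).trans Finset.sum_add_distrib
  refine Finsupp.sum_add_index' (fun k => ?_) (fun k a b => ?_)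
  · simp only [map_zero, mul_zero, single_zero]
  · simp only [map_add, mul_add, single_add]

theorem single_mul_single (h k : H) (a b : A) :
    single α h a * single α k b = single α (h * k) (a * α h b) := by
  refine (Finsupp.sum_single_index ?_).trans (Finsupp.sum_single_index ?_)
  · simp only [zero_mul, single_zero]
    exact Finset.sum_const_zero
  · simp only [map_zero, mul_zero, single_zero]

theorem star_single (h : H) (a : A) :
    star (single α h a) = single α h⁻¹ (α h⁻¹ (star a)) := by
  refine Finsupp.sum_single_index ?_
  simp only [star_zero, map_zero, single_zero]

theorem star_add' (f g : ConvAlgebra α) : star (f + g) = star f + star g := by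
  refine Finsupp.sum_add_index' (fun h => ?_) (fun h a b => ?_)
  · simp only [star_zero, map_zero, single_zero]
  · simp only [star_add, map_add, single_add]

theorem star_zero' : star (0 : ConvAlgebra α) = 0 := Finsupp.sum_zero_index

theorem smul_mul' (c : ℂ) (f g : ConvAlgebra α) : (c • f) * g = c • (f * g) := by
  induction f using induction with
  | zero => simp only [smul_zero, zero_mul']
  | add f f' hf hf' => simp only [smul_add, add_mul', hf, hf']
  | single h a =>
    induction g using induction with
    | zero => simp only [smul_zero, mul_zero']
    | add g g' hg hg' => simp only [smul_add, mul_add', hg, hg']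
    | single k b => simp only [smul_single, single_mul_single, smul_mul_assoc]

theorem mul_smul' (c : ℂ) (f g : ConvAlgebra α) : f * (c • g) = c • (f * g) := by
  induction f using induction with
  | zero => simp only [smul_zero, zero_mul']
  | add f f' hf hf' => simp only [smul_add, add_mul', hf, hf']
  | single h a =>
    induction g using induction with
    | zero => simp only [smul_zero, mul_zero']
    | add g g' hg hg' => simp only [smul_add, mul_add', hg, hg']
    | single k b => simp only [smul_single, single_mul_single, map_smul, mul_smul_comm]

theorem mul_assoc' (f g k : ConvAlgebra α) : f * g * k = f * (g * k) := by
  induction f using induction with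
  | zero => simp only [zero_mul']
  | add f f' hf hf' => simp only [add_mul', hf, hf']
  | single h a =>
    induction g using induction with
    | zero => simp only [zero_mul', mul_zero']
    | add g g' hg hg' => simp only [mul_add', add_mul', hg, hg']
    | single h' b =>
      induction k using induction with
      | zero => simp only [mul_zero']
      | add g g' hg hg' => simp only [mul_add', hg, hg']
      | single k c =>
        rw [single_mul_single, single_mul_single, single_mul_single, single_mul_single, act_mul,
          map_mul, mul_assoc, mul_assoc]

theorem star_star' (f : ConvAlgebra α) : star (star f) = f := by
  induction f using induction with
  | zero => simp only [star_zero']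
  | add f f' hf hf' => simp only [star_add', hf, hf']
  | single h a =>
    rw [star_single, star_single, ← map_star, star_star, act_inv_act, inv_inv]

theorem star_mul' (f g : ConvAlgebra α) : star (f * g) = star g * star f := by
  induction f using induction with
  | zero => simp only [zero_mul', star_zero', mul_zero']
  | add f f' hf hf' => simp only [add_mul', star_add', mul_add', hf, hf']
  | single h a =>
    induction g using induction with
    | zero => simp only [zero_mul', star_zero', mul_zero']
    | add g g' hg hg' => simp only [mul_add', star_add', add_mul', hg, hg']
    | single k b =>
      rw [star_single, star_single, single_mul_single, single_mul_single, star_single,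
        mul_inv_rev, star_mul, map_mul, ← map_star (α h), act_mul _ _ (α h (star b)), act_inv_act,
        ← act_mul]

theorem star_smul' (c : ℂ) (f : ConvAlgebra α) : star (c • f) = star c • star f := by
  induction f using induction with
  | zero => simp only [smul_zero, star_zero']
  | add f f' hf hf' => simp only [smul_add, star_add', hf, hf']
  | single h a => simp only [smul_single, star_single, star_smul, map_smul]

noncomputable instance : NonUnitalRing (ConvAlgebra α) :=
  { (inferInstance : AddCommGroup (ConvAlgebra α)), (inferInstance : Mul (ConvAlgebra α)) with
    zero_mul := zero_mul'
    mul_zero := mul_zero'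
    left_distrib := mul_add'
    right_distrib := add_mul'
    mul_assoc := mul_assoc' }

noncomputable instance : StarRing (ConvAlgebra α) where
  star_involutive := star_star'
  star_mul := star_mul'
  star_add := star_add'

instance : IsScalarTower ℂ (ConvAlgebra α) (ConvAlgebra α) := ⟨smul_mul'⟩

instance : SMulCommClass ℂ (ConvAlgebra α) (ConvAlgebra α) := ⟨fun c f g => (mul_smul' c f g).symm⟩

instance : StarModule ℂ (ConvAlgebra α) := ⟨star_smul'⟩

/-- The C*-seminorms on `C_c(H, A)` that are dominated by the `ℓ¹`-norm. -/
structure IsCStarSeminorm (p : Seminorm ℂ (ConvAlgebra α)) : Prop where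
  mul_le : ∀ f g, p (f * g) ≤ p f * p g
  star_mul_self : ∀ f, p (star f * f) = p f ^ 2
  le_l1Norm : ∀ f, p f ≤ l1Norm f

theorem IsCStarSeminorm.star_le {p : Seminorm ℂ (ConvAlgebra α)} (hp : IsCStarSeminorm p)
    (f : ConvAlgebra α) : p f ≤ p (star f) := by
  have h := (hp.star_mul_self f).symm.trans_le (hp.mul_le _ _)
  rcases (apply_nonneg p f).eq_or_lt with h0 | h0
  · rw [← h0]; exact apply_nonneg p _
  · rw [sq] at h
    exact le_of_mul_le_mul_right h h0

variable (α) in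
/-- The index set of all such seminorms. -/
abbrev CStarSeminorm := {p : Seminorm ℂ (ConvAlgebra α) // IsCStarSeminorm p}

theorem isCStarSeminorm_zero : IsCStarSeminorm (0 : Seminorm ℂ (ConvAlgebra α)) where
  mul_le _ _ := by simp
  star_mul_self _ := by simp
  le_l1Norm f := Finset.sum_nonneg fun _ _ => norm_nonneg _

instance : Nonempty (CStarSeminorm α) := ⟨⟨0, isCStarSeminorm_zero⟩⟩

theorem bddAbove (f : ConvAlgebra α) :
    BddAbove (Set.range fun p : CStarSeminorm α => p.1 f) :=
  ⟨l1Norm f, by rintro _ ⟨p, rfl⟩; exact p.2.le_l1Norm f⟩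

theorem le_iSup (p : CStarSeminorm α) (f : ConvAlgebra α) :
    p.1 f ≤ ⨆ q : CStarSeminorm α, q.1 f :=
  le_ciSup (bddAbove f) p

/-- The universal norm on `C_c(H, A)`: the supremum of all its C*-seminorms. -/
noncomputable instance : SeminormedAddCommGroup (ConvAlgebra α) :=
  AddGroupSeminorm.toSeminormedAddCommGroup
    { toFun := fun f : ConvAlgebra α => ⨆ p : CStarSeminorm α, p.1 f
      map_zero' := by simp
      add_le' := fun f g => ciSup_le fun p =>
        (map_add_le_add p.1 f g).trans (add_le_add (le_iSup p f) (le_iSup p g))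
      neg' := fun f => by simp }

theorem norm_def (f : ConvAlgebra α) : ‖f‖ = ⨆ p : CStarSeminorm α, p.1 f := rfl

theorem le_norm (p : CStarSeminorm α) (f : ConvAlgebra α) : p.1 f ≤ ‖f‖ := le_iSup p f

noncomputable instance : NonUnitalSeminormedRing (ConvAlgebra α) :=
  { (inferInstance : SeminormedAddCommGroup (ConvAlgebra α)),
    (inferInstance : NonUnitalRing (ConvAlgebra α)) with
    norm_mul_le := fun f g => ciSup_le fun p =>
      (p.2.mul_le f g).trans
        (mul_le_mul (le_norm p f) (le_norm p g) (apply_nonneg _ _) (norm_nonneg f)) }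

noncomputable instance : NormedSpace ℂ (ConvAlgebra α) where
  norm_smul_le c f := ciSup_le fun p => by
    rw [map_smul_eq_mul]
    exact mul_le_mul_of_nonneg_left (le_norm p f) (norm_nonneg c)

instance : NormedStarGroup (ConvAlgebra α) where
  norm_star_le f := ciSup_le fun p =>
    ((p.2.star_le (star f)).trans_eq (by rw [star_star])).trans (le_norm p f)

theorem norm_mul_self_le (f : ConvAlgebra α) : ‖f‖ * ‖f‖ ≤ ‖star f * f‖ := by
  have h : ‖f‖ ≤ Real.sqrt ‖star f * f‖ := ciSup_le fun p =>
    Real.le_sqrt_of_sq_le ((p.2.star_mul_self f).symm.trans_le (le_norm p _))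
  exact (mul_self_le_mul_self (norm_nonneg f) h).trans_eq (Real.mul_self_sqrt (norm_nonneg _))

end ConvAlgebra

/-- The full crossed product `A ⋊_α H` of the C*-algebra `A` by the action `α` of the discrete
group `H`: the completion of the `*`-algebra `C_c(H, A)` in its universal C*-norm. -/
def FullCrossedProduct (α : H →* (A →⋆ₙₐ[ℂ] A)) := UniformSpace.Completion (ConvAlgebra α)

namespace FullCrossedProduct

variable (α : H →* (A →⋆ₙₐ[ℂ] A))

noncomputable instance : NonUnitalCStarAlgebra (FullCrossedProduct α) :=
  CStarCompletion.nonUnitalCStarAlgebra (E := ConvAlgebra α) ConvAlgebra.norm_mul_self_le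

/-- The element `i_A(a) i_H(h)` of the crossed product, for `a` in `A` and `h` in `H`. -/
noncomputable def of (h : H) (a : A) : FullCrossedProduct α :=
  UniformSpace.Completion.coe' (ConvAlgebra.single α h a)

variable {α}

theorem of_mul_of (h k : H) (a b : A) : of α h a * of α k b = of α (h * k) (a * α h b) := by
  rw [of, of, of, ← ConvAlgebra.single_mul_single]
  exact (CStarCompletion.coe_mul _ _).symm

theorem star_of (h : H) (a : A) : star (of α h a) = of α h⁻¹ (α h⁻¹ (star a)) := by
  rw [of, of, ← ConvAlgebra.star_single]
  exact (CStarCompletion.coe_star _).symm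

end FullCrossedProduct

end FullCrossedProduct

/-! ### Corners -/

section Corner

variable {C : Type*} [NonUnitalCStarAlgebra C]

/-- The corner `p C p` as a `*`-subalgebra of `C`, for a projection `p` of `C`. -/
def cornerSubalgebra (p : C) (hp : IsStarProjection p) : NonUnitalStarSubalgebra ℂ C where
  carrier := {x | ∃ c, x = p * c * p}
  zero_mem' := ⟨0, by simp⟩
  add_mem' := by
    rintro _ _ ⟨c, rfl⟩ ⟨d, rfl⟩
    exact ⟨c + d, by rw [mul_add, add_mul]⟩
  mul_mem' := by
    rintro _ _ ⟨c, rfl⟩ ⟨d, rfl⟩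
    exact ⟨c * p * (p * d), by simp only [mul_assoc]⟩
  smul_mem' := by
    rintro r _ ⟨c, rfl⟩
    exact ⟨r • c, by rw [mul_smul_comm, smul_mul_assoc]⟩
  star_mem' := by
    rintro _ ⟨c, rfl⟩
    exact ⟨star c, by rw [star_mul, star_mul, hp.isSelfAdjoint.star_eq, mul_assoc]⟩

variable {p : C} (hp : IsStarProjection p)

theorem mem_cornerSubalgebra {x : C} : x ∈ cornerSubalgebra p hp ↔ p * x * p = x := by
  constructor
  · rintro ⟨c, rfl⟩
    have h := hp.isIdempotentElem.eq
    rw [mul_assoc, mul_assoc, mul_assoc, mul_assoc, h, ← mul_assoc p p, h]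
  · exact fun h => ⟨x, h.symm⟩

theorem isClosed_cornerSubalgebra : IsClosed (cornerSubalgebra p hp : Set C) := by
  have : (cornerSubalgebra p hp : Set C) = {x | p * x * p = x} :=
    Set.ext fun _ => mem_cornerSubalgebra hp
  rw [this]
  exact isClosed_eq (by fun_prop) (by fun_prop)

/-- The corner `p C p` as a C*-algebra in its own right. -/
def Corner (p : C) (hp : IsStarProjection p) : Type _ := cornerSubalgebra p hp

namespace Corner

/-- The structure inherited from `C`, without the unit. -/
noncomputable abbrev nonUnitalCStarAlgebra : NonUnitalCStarAlgebra (Corner p hp) :=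
  NonUnitalStarSubalgebra.nonUnitalCStarAlgebra (cornerSubalgebra p hp)
    (h_closed := isClosed_cornerSubalgebra hp)

/-- `p C p` is a unital C*-algebra, with unit `p` and all other operations inherited from `C`. -/
noncomputable instance : CStarAlgebra (Corner p hp) :=
  letI := nonUnitalCStarAlgebra hp
  letI : NormedRing (Corner p hp) :=
    { (inferInstance : NonUnitalNormedRing (Corner p hp)) with
      one := ⟨p, p, by rw [hp.isIdempotentElem.eq, hp.isIdempotentElem.eq]⟩
      one_mul := by
        rintro ⟨_, c, rfl⟩
        exact Subtype.ext (by
          change p * (p * c * p) = p * c * p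
          rw [← mul_assoc, ← mul_assoc, hp.isIdempotentElem.eq])
      mul_one := by
        rintro ⟨_, c, rfl⟩
        exact Subtype.ext (by
          change p * c * p * p = p * c * p
          rw [mul_assoc, hp.isIdempotentElem.eq]) }
  letI : NormedAlgebra ℂ (Corner p hp) :=
    { Algebra.ofModule smul_mul_assoc mul_smul_comm with
      norm_smul_le := norm_smul_le }
  { (inferInstance : NormedRing (Corner p hp)), (inferInstance : NormedAlgebra ℂ (Corner p hp)),
    (inferInstance : StarRing (Corner p hp)), (inferInstance : CStarRing (Corner p hp)),
    (inferInstance : StarModule ℂ (Corner p hp)),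
    (inferInstance : CompleteSpace (Corner p hp)) with }

end Corner

end Corner

/-! ### The algebra `D` and the corner `p (D ⋊ H) p` -/

namespace AxPlusB

open scoped Pointwise

variable {N H : Type*}

/-- The characteristic function of `S`, as an element of `ℓ^∞(N)`. -/
noncomputable def charFun (S : Set N) : lp (fun _ : N => ℂ) ⊤ :=
  ⟨S.indicator 1, memℓp_infty ⟨1, by
    rintro _ ⟨n, rfl⟩
    by_cases h : n ∈ S <;> simp [h]⟩⟩

theorem charFun_mul {S T : Set N} (h : S ⊆ T) : charFun S * charFun T = charFun S := by
  ext x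
  change S.indicator (1 : N → ℂ) x * T.indicator (1 : N → ℂ) x = S.indicator (1 : N → ℂ) x
  by_cases hx : x ∈ S
  · simp [hx, h hx]
  · simp [hx]

theorem star_charFun (S : Set N) : star (charFun S) = charFun S := by
  ext x
  change star (S.indicator (1 : N → ℂ) x) = S.indicator (1 : N → ℂ) x
  by_cases hx : x ∈ S <;> simp [hx]

section Action

variable [Group N] [Group H] (φ : H →* MulAut N)

/-- The `*`-homomorphism `f ↦ f ∘ φ_h⁻¹` of `ℓ^∞(N)`. -/
noncomputable def translate (h : H) : lp (fun _ : N => ℂ) ⊤ →⋆ₙₐ[ℂ] lp (fun _ : N => ℂ) ⊤ where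
  toFun f := ⟨fun n => f (φ h⁻¹ n), memℓp_infty (by
    obtain ⟨c, hc⟩ := (lp.memℓp f).bddAbove
    exact ⟨c, by rintro _ ⟨n, rfl⟩; exact hc ⟨φ h⁻¹ n, rfl⟩⟩)⟩
  map_smul' _ _ := rfl
  map_zero' := rfl
  map_add' _ _ := rfl
  map_mul' _ _ := rfl
  map_star' _ := rfl

theorem continuous_translate (h : H) : Continuous (translate φ h) := by
  refine AddMonoidHomClass.continuous_of_bound (translate φ h) 1 fun f => ?_
  rw [one_mul]
  exact lp.norm_le_of_forall_le (norm_nonneg f) fun n =>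
    lp.norm_apply_le_norm ENNReal.top_ne_zero f (φ h⁻¹ n)

variable (M : Subgroup N)

/-- The subgroup `h M h⁻¹` of `N`, formed in `N ⋊ H`, where `h n h⁻¹ = φ h n`. -/
def conj (h : H) : Subgroup N := M.map (φ h).toMonoidHom

/-- The characteristic function of the coset `n (h M h⁻¹)`. -/
noncomputable def cosetFun (h : H) (n : N) : lp (fun _ : N => ℂ) ⊤ :=
  charFun (n • (conj φ M h : Set N))

theorem translate_cosetFun (g h : H) (n : N) :
    translate φ g (cosetFun φ M h n) = cosetFun φ M (g * h) (φ g n) := by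
  ext x
  change (n • (conj φ M h : Set N)).indicator 1 (φ g⁻¹ x) =
    (φ g n • (conj φ M (g * h) : Set N)).indicator (1 : N → ℂ) x
  have : φ g⁻¹ x ∈ n • (conj φ M h : Set N) ↔ x ∈ φ g n • (conj φ M (g * h) : Set N) := by
    simp only [Set.mem_smul_set_iff_inv_smul_mem, smul_eq_mul, SetLike.mem_coe, conj,
      Subgroup.mem_map, map_mul, map_inv]
    refine exists_congr fun y => and_congr_right fun _ => ?_
    change φ h y = n⁻¹ * (φ g)⁻¹ x ↔ φ g (φ h y) = (φ g n)⁻¹ * x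
    rw [← (φ g).injective.eq_iff, map_mul, map_inv, MulAut.apply_inv_self]
  by_cases hx : x ∈ φ g n • (conj φ M (g * h) : Set N)
  · rw [Set.indicator_of_mem hx, Set.indicator_of_mem (this.2 hx)]; rfl
  · rw [Set.indicator_of_notMem hx, Set.indicator_of_notMem (mt this.1 hx)]

/-- The C*-subalgebra `D` of `ℓ^∞(N)` generated by the characteristic functions of all cosets
`n (h M h⁻¹)`. -/
noncomputable def DSub : NonUnitalStarSubalgebra ℂ (lp (fun _ : N => ℂ) ⊤) :=
  (NonUnitalStarAlgebra.adjoin ℂ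
    {f | ∃ (h : H) (n : N), f = cosetFun φ M h n}).topologicalClosure

/-- `D` as a C*-algebra in its own right. -/
def D : Type _ := DSub φ M

noncomputable instance : NonUnitalCStarAlgebra (D φ M) :=
  NonUnitalStarSubalgebra.nonUnitalCStarAlgebra (DSub φ M)
    (h_closed := NonUnitalStarSubalgebra.isClosed_topologicalClosure _)

theorem cosetFun_mem (h : H) (n : N) : cosetFun φ M h n ∈ DSub φ M :=
  NonUnitalStarSubalgebra.le_topologicalClosure _
    (NonUnitalStarAlgebra.subset_adjoin ℂ _ ⟨h, n, rfl⟩)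

theorem translate_mem (g : H) {f : lp (fun _ : N => ℂ) ⊤} (hf : f ∈ DSub φ M) :
    translate φ g f ∈ DSub φ M := by
  have hle : NonUnitalStarAlgebra.adjoin ℂ {f | ∃ (h : H) (n : N), f = cosetFun φ M h n} ≤
      (DSub φ M).comap (translate φ g) := by
    refine NonUnitalStarAlgebra.adjoin_le ?_
    rintro _ ⟨h, n, rfl⟩
    change translate φ g _ ∈ DSub φ M
    rw [translate_cosetFun]
    exact cosetFun_mem φ M _ _
  have hcl : IsClosed ((DSub φ M).comap (translate φ g) : Set (lp (fun _ : N => ℂ) ⊤)) :=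
    (NonUnitalStarSubalgebra.isClosed_topologicalClosure _).preimage (continuous_translate φ g)
  exact NonUnitalStarSubalgebra.topologicalClosure_minimal _ hle hcl hf

/-- The action `α` of `H` on `D`, `α_h(f) = f ∘ φ_h⁻¹`. -/
noncomputable def action : H →* (D φ M →⋆ₙₐ[ℂ] D φ M) where
  toFun h :=
    { toFun := fun f => ⟨translate φ h f.1, translate_mem φ M h f.2⟩
      map_smul' := fun _ _ => rfl
      map_zero' := rfl
      map_add' := fun _ _ => rfl
      map_mul' := fun _ _ => rfl
      map_star' := fun _ => rfl }
  map_one' := by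
    refine NonUnitalStarAlgHom.ext fun f => Subtype.ext (lp.ext (funext fun n => ?_))
    change f.1 (φ 1⁻¹ n) = f.1 n
    rw [inv_one, map_one]; rfl
  map_mul' g h := by
    refine NonUnitalStarAlgHom.ext fun f => Subtype.ext (lp.ext (funext fun n => ?_))
    change f.1 (φ (g * h)⁻¹ n) =
      f.1 (φ h⁻¹ (φ g⁻¹ n))
    rw [mul_inv_rev, map_mul]; rfl

/-- The characteristic function of the coset `n (h M h⁻¹)`, as an element of `D`. -/
noncomputable def cosetD (h : H) (n : N) : D φ M := ⟨cosetFun φ M h n, cosetFun_mem φ M h n⟩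

/-- The full crossed product `C = D ⋊_α H`. -/
abbrev C := FullCrossedProduct (action φ M)

/-- The projection `p = χ_M` in `C`. -/
noncomputable def p : C φ M := .of (action φ M) 1 (cosetD φ M 1 1)

theorem cosetFun_one_one : cosetFun φ M 1 1 = charFun (M : Set N) := by
  rw [cosetFun, conj, one_smul, map_one]
  congr 1
  ext x
  simp

theorem of_one_mul_of_one (f g : D φ M) :
    (.of (action φ M) 1 f * .of (action φ M) 1 g : C φ M) = .of (action φ M) 1 (f * g) := by
  rw [FullCrossedProduct.of_mul_of, map_one, one_mul]; rfl

theorem isStarProjection_p : IsStarProjection (p φ M) where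
  isIdempotentElem := by
    rw [IsIdempotentElem, p, of_one_mul_of_one]
    congr 1
    exact Subtype.ext (charFun_mul subset_rfl)
  isSelfAdjoint := by
    rw [IsSelfAdjoint, p, FullCrossedProduct.star_of, inv_one, map_one]
    congr 1
    exact Subtype.ext (star_charFun _)

/-- The unital C*-algebra `p C p`. -/
abbrev PCP := Corner (p φ M) (isStarProjection_p φ M)

/-- `H⁺`, the set of all `a` in `H` with `a M a⁻¹ ⊆ M`. -/
def HPlus : Submonoid H where
  carrier := {a | conj φ M a ≤ M}
  one_mem' := by
    rintro _ ⟨x, hx, rfl⟩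
    simpa using hx
  mul_mem' := by
    rintro a b ha hb _ ⟨x, hx, rfl⟩
    refine ha ⟨φ b x, hb ⟨x, hx, rfl⟩, ?_⟩
    rw [map_mul]; rfl

variable {φ M}

/-- The element `a m a⁻¹` of `M`, for `a` in `H⁺` and `m` in `M`. -/
def conjM (a : HPlus φ M) (m : M) : M := ⟨φ a m, a.2 ⟨m, m.2, rfl⟩⟩

/-- The element `s_a = p a p` of `p C p`. (In the middle, `p a` is the element `i_D(χ_M) i_H(a)`
of `C`, so the value is `p (p a) p = p a p`.) -/
noncomputable def sElem (a : HPlus φ M) : PCP φ M :=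
  ⟨p φ M * .of (action φ M) (a : H) (cosetD φ M 1 1) * p φ M, _, rfl⟩

/-- The element `p(a, m) = χ_{m a M a⁻¹}` of `p C p`. -/
noncomputable def pElem (a : HPlus φ M) (m : M) : PCP φ M :=
  ⟨.of (action φ M) 1 (cosetD φ M (a : H) (m : N)), (mem_cornerSubalgebra _).2 (by
    have hsub : (m : N) • (conj φ M (a : H) : Set N) ⊆ M := by
      rintro _ ⟨x, hx, rfl⟩
      exact M.mul_mem m.2 (a.2 hx)
    have h1 : cosetFun φ M (a : H) (m : N) * cosetFun φ M 1 1 = cosetFun φ M (a : H) (m : N) := by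
      rw [cosetFun_one_one]; exact charFun_mul hsub
    rw [p, of_one_mul_of_one, of_one_mul_of_one]
    congr 1
    refine Subtype.ext ?_
    change cosetFun φ M 1 1 * cosetFun φ M (a : H) (m : N) * cosetFun φ M 1 1 = _
    rw [mul_comm (cosetFun φ M 1 1), h1, h1]
    rfl)⟩

/-- SP-families in a unital C*-algebra `B`. The sum over `m b M b⁻¹ ∈ M / b M b⁻¹` in the last
relation is the sum over `m ∈ T`, for any choice of a complete set `T` of representatives. -/
structure IsSPFamily {B : Type*} [CStarAlgebra B] (S : HPlus φ M → B) (P : HPlus φ M → M → B) :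
    Prop where
  isometry : ∀ a, star (S a) * S a = 1
  projection : ∀ a m, IsStarProjection (P a m)
  s_mul : ∀ a b, S a * S b = S (a * b)
  p_one : P 1 1 = 1
  s_p : ∀ a b m, S a * P b m * star (S a) = P (a * b) (conjM a m)
  p_sum : ∀ (a b : HPlus φ M) (k : M) (T : Finset M),
    Subgroup.IsComplement (T : Set M) ((conj φ M (b : H)).subgroupOf M : Set M) →
      P a k = ∑ m ∈ T, P (a * b) (k * conjM a m)

end Action

end AxPlusB

/-! An SP-family is a compressed picture of a covariant pair. Write `i_D`, `i_H` for the canonical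
maps into the crossed product. For a right `cMc⁻¹`-invariant function `f`, the projection `P(c,m)`
must see `f` as the scalar `f(m)`, so the family determines `ρ(f) = ∑ f(m) P(c,m)` over `M/cMc⁻¹`.
These sums are *-homomorphisms on all of `D`, hence contractive, and their limit over `c` is `ρ`
(`exists_rho`). Every `g` in `H` is a fraction `c⁻¹b` with `b, c ∈ H⁺`, and `V_g = S_c^* S_b` does
not depend on the fraction because `H` is abelian (`exists_V`).

The pair is covariant, but `V` is not a representation: `V_g V_k = ρ(χ_{gMg⁻¹}) V_{gk}` (`V_mul_V`).
Accordingly `θ_1 : ∑ f_g g ↦ ∑ ρ(f_g) V_g` is not multiplicative on `C_c(H, D)`; on the crossed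
product it satisfies `Θ(x)Θ(y) = Θ(x p y)`, which is multiplicativity exactly where it is needed, on
`pCp`.

The main difficulty is that `θ_1` is contractive for the universal norm. Rather than dilating `V` to
unitaries, the proof uses `θ_a(F) = ∑ ρ(α_a(f_g)) V_g`, formally `θ_1(aFa⁻¹)`. On the one hand
`S_a^* θ_a(F) S_a = θ_1(F)`. On the other hand the multiplicative defect of `θ_a` comes from the
cut-off `χ_{a⁻¹gMg⁻¹a}`, which tends to the identity on `D` as `a` grows in `H⁺`
(`tendsto_mul_cosetD`). Hence a limit of the norms `‖θ_a(F)‖` is a C*-seminorm dominating `‖θ_1(F)‖`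
(`norm_theta_one_le`).

Uniqueness holds because `pCp` is generated by the family: `p (f g) p = (p f p) s_c^* s_b`, and `p f
p` is a limit of linear combinations of the `p(c,m)` (`hom_ext`). -/

namespace AxPlusB

open scoped Pointwise
open Filter Topology

/-! ### Conjugates of `M`, fractions in `H`, and a dense *-algebra of tame functions. -/

section Tame

variable {N H : Type*} [Group N] [CommGroup H] {φ : H →* MulAut N} {M : Subgroup N}

theorem mem_conj {h : H} {x : N} : x ∈ conj φ M h ↔ φ h⁻¹ x ∈ M := by
  constructor
  · rintro ⟨y, hy, rfl⟩
    have : φ h⁻¹ (φ h y) = y := by rw [map_inv, MulAut.inv_apply_self]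
    exact this.symm ▸ hy
  · intro hx
    exact ⟨_, hx, by rw [map_inv]; exact MulAut.apply_inv_self _ _ _⟩

theorem mul_apply (g h : H) (x : N) : φ (g * h) x = φ g (φ h x) := by
  rw [map_mul]; rfl

theorem apply_mem_conj {g h : H} {x : N} : φ g x ∈ conj φ M h ↔ x ∈ conj φ M (g⁻¹ * h) := by
  rw [mem_conj, mem_conj, ← mul_apply, mul_inv_rev, inv_inv]

theorem conj_one : conj φ M 1 = M := by
  ext x
  rw [mem_conj, inv_one, map_one, MulAut.one_apply]

theorem conj_le_conj {g h : H} : conj φ M g ≤ conj φ M h ↔ h⁻¹ * g ∈ HPlus φ M := by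
  change _ ↔ conj φ M (h⁻¹ * g) ≤ M
  constructor
  · rintro hle x hx
    rw [← apply_mem_conj] at hx
    have := hle hx
    rwa [apply_mem_conj, inv_mul_cancel, conj_one] at this
  · intro hle x hx
    have hx' : φ h⁻¹ x ∈ conj φ M (h⁻¹ * g) := by
      rwa [apply_mem_conj, inv_inv, mul_inv_cancel_left]
    exact mem_conj.2 (hle hx')

theorem conj_mul_le (a : H) (b : HPlus φ M) : conj φ M (a * b) ≤ conj φ M a :=
  conj_le_conj.2 (by rw [inv_mul_cancel_left]; exact b.2)

theorem conj_inv_le_mul (a : H) (b : HPlus φ M) : conj φ M a⁻¹ ≤ conj φ M (a * b)⁻¹ :=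
  conj_le_conj.2 (by rw [inv_inv, mul_right_comm, mul_inv_cancel, one_mul]; exact b.2)

theorem exists_conj_le
    (hfilter : ∀ a b : H, ∃ c : H, conj φ M c ≤ conj φ M a ⊓ conj φ M b) (h : H) :
    ∃ c : HPlus φ M, conj φ M c ≤ conj φ M h := by
  obtain ⟨c, hc⟩ := hfilter 1 h
  rw [conj_one] at hc
  exact ⟨⟨c, hc.trans inf_le_left⟩, hc.trans inf_le_right⟩

/-- `H` is the group of fractions of `H⁺`: if `cMc⁻¹ ⊆ h⁻¹Mh` with `c ∈ H⁺`, then `ch` lies in `H⁺`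
as well. -/
theorem exists_mul_mem_HPlus
    (hfilter : ∀ a b : H, ∃ c : H, conj φ M c ≤ conj φ M a ⊓ conj φ M b) (h : H) :
    ∃ b c : HPlus φ M, (c : H) * h = b := by
  obtain ⟨c, hc⟩ := exists_conj_le hfilter h⁻¹
  refine ⟨⟨c * h, ?_⟩, c, rfl⟩
  have := conj_le_conj.1 hc
  rwa [inv_inv, mul_comm] at this

/-- A function on `N` is tame of level `c` if it is invariant under right translation by `c M c⁻¹`
and supported in `c⁻¹ M c`. -/
structure IsTame (φ : H →* MulAut N) (M : Subgroup N) (c : H) (f : N → ℂ) : Prop where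
  invariant : ∀ n, ∀ x ∈ conj φ M c, f (n * x) = f n
  support : ∀ n, f n ≠ 0 → n ∈ conj φ M c⁻¹

theorem IsTame.mul_right {c : H} {f : N → ℂ} (hf : IsTame φ M c f) (d : HPlus φ M) :
    IsTame φ M (c * d) f :=
  ⟨fun n x hx => hf.invariant n x (conj_mul_le c d hx),
    fun n hn => conj_inv_le_mul c d (hf.support n hn)⟩

/-- Passing to a multiple of the level shrinks the invariance group and enlarges the allowed
support, so the product of two levels serves both functions. This is what makes tame functions an
algebra. -/
theorem IsTame.exists_common {c d : HPlus φ M} {f g : N → ℂ} (hf : IsTame φ M c f)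
    (hg : IsTame φ M d g) : ∃ e : HPlus φ M, IsTame φ M e f ∧ IsTame φ M e g :=
  ⟨c * d, hf.mul_right d, by
    rw [mul_comm]; exact hg.mul_right c⟩

theorem cosetFun_apply_of_mem {h : H} {n x : N} (hx : n⁻¹ * x ∈ conj φ M h) :
    cosetFun φ M h n x = 1 := by
  refine Set.indicator_of_mem ?_ _
  rwa [Set.mem_smul_set_iff_inv_smul_mem]

theorem cosetFun_apply_of_notMem {h : H} {n x : N} (hx : n⁻¹ * x ∉ conj φ M h) :
    cosetFun φ M h n x = 0 := by
  refine Set.indicator_of_notMem ?_ _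
  rwa [Set.mem_smul_set_iff_inv_smul_mem]

theorem cosetFun_mul_right {h : H} {n m x : N} (hx : x ∈ conj φ M h) :
    cosetFun φ M h n (m * x) = cosetFun φ M h n m := by
  have key : n⁻¹ * (m * x) ∈ conj φ M h ↔ n⁻¹ * m ∈ conj φ M h := by
    rw [← mul_assoc]; exact Subgroup.mul_mem_cancel_right _ hx
  by_cases hm : n⁻¹ * m ∈ conj φ M h
  · rw [cosetFun_apply_of_mem hm, cosetFun_apply_of_mem (key.2 hm)]
  · rw [cosetFun_apply_of_notMem hm, cosetFun_apply_of_notMem (mt key.1 hm)]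

theorem exists_isTame_cosetFun
    (hfilter : ∀ a b : H, ∃ c : H, conj φ M c ≤ conj φ M a ⊓ conj φ M b)
    (hcover : ∀ n : N, ∃ a ∈ HPlus φ M, n ∈ conj φ M a⁻¹) (h : H) (n : N) :
    ∃ c : HPlus φ M, IsTame φ M c (cosetFun φ M h n) := by
  obtain ⟨c₁, hc₁⟩ := exists_conj_le hfilter h
  obtain ⟨b, c₂, hb⟩ := exists_mul_mem_HPlus hfilter h
  obtain ⟨c₃', hc₃, hn⟩ := hcover n
  lift c₃' to HPlus φ M using hc₃ with c₃
  -- The factor `c₁` secures invariance, since `c₁Mc₁⁻¹ ⊆ hMh⁻¹`. The other two secure the support: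
  -- `c₂⁻¹Mc₂` contains `hMh⁻¹` and `c₃⁻¹Mc₃` contains `n`.
  refine ⟨c₁ * (c₂ * c₃), ⟨fun m x hx => ?_, fun m hm => ?_⟩⟩
  · exact cosetFun_mul_right (hc₁ (conj_mul_le (c₁ : H) (c₂ * c₃) hx))
  · have hm' : n⁻¹ * m ∈ conj φ M h := by
      by_contra hm'
      exact hm (cosetFun_apply_of_notMem hm')
    have h2 : conj φ M h ≤ conj φ M (c₂ : H)⁻¹ :=
      conj_le_conj.2 (by rw [inv_inv, hb]; exact b.2)
    have h3 := conj_inv_le_mul (c₂ : H) (c₃ * c₁) (h2 hm')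
    have h4 := conj_inv_le_mul (c₃ : H) (c₁ * c₂) hn
    rw [← Submonoid.coe_mul] at h3 h4
    have e3 : c₂ * (c₃ * c₁) = c₁ * (c₂ * c₃) := by rw [← mul_assoc, mul_comm]
    have e4 : c₃ * (c₁ * c₂) = c₁ * (c₂ * c₃) := by rw [mul_comm, mul_assoc]
    rw [e3] at h3
    rw [e4] at h4
    have := mul_mem h4 h3
    rwa [mul_inv_cancel_left] at this

variable (φ M) in
/-- The `*`-algebra of bounded functions which are tame of some level in `H⁺`. -/
noncomputable def tameSub : NonUnitalStarSubalgebra ℂ (lp (fun _ : N => ℂ) ⊤) where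
  carrier := {f | ∃ c : HPlus φ M, IsTame φ M c f}
  zero_mem' := ⟨1, fun _ _ _ => rfl, fun _ hn => absurd rfl hn⟩
  add_mem' := by
    rintro f g ⟨c, hf⟩ ⟨d, hg⟩
    obtain ⟨e, hf, hg⟩ := hf.exists_common hg
    refine ⟨e, fun n x hx => ?_, fun n hn => ?_⟩
    · exact congrArg₂ (· + ·) (hf.invariant n x hx) (hg.invariant n x hx)
    · by_cases h0 : f n = 0
      · refine hg.support n fun h1 => hn ?_
        change f n + g n = 0
        rw [h0, h1, add_zero]
      · exact hf.support n h0
  mul_mem' := by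
    rintro f g ⟨c, hf⟩ ⟨d, hg⟩
    obtain ⟨e, hf, hg⟩ := hf.exists_common hg
    refine ⟨e, fun n x hx => ?_, fun n hn => hf.support n (left_ne_zero_of_mul hn)⟩
    exact congrArg₂ (· * ·) (hf.invariant n x hx) (hg.invariant n x hx)
  smul_mem' := by
    rintro r f ⟨c, hf⟩
    refine ⟨c, fun n x hx => ?_, fun n hn => hf.support n (right_ne_zero_of_mul hn)⟩
    exact congrArg (r * ·) (hf.invariant n x hx)
  star_mem' := by
    rintro f ⟨c, hf⟩
    refine ⟨c, fun n x hx => ?_, fun n hn => hf.support n fun h0 => hn ?_⟩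
    · exact congrArg star (hf.invariant n x hx)
    · change star (f n) = 0
      rw [h0, star_zero]

theorem isometry_val : Isometry (fun f : D φ M => f.1) := fun _ _ => rfl

/-- A closed property of elements of `D` which holds for all tame elements holds on `D`. -/
theorem D.induction_tame
    (hfilter : ∀ a b : H, ∃ c : H, conj φ M c ≤ conj φ M a ⊓ conj φ M b)
    (hcover : ∀ n : N, ∃ a ∈ HPlus φ M, n ∈ conj φ M a⁻¹) {P : D φ M → Prop}
    (hcl : IsClosed {f | P f}) (htame : ∀ (c : HPlus φ M) (f : D φ M), IsTame φ M c f.1 → P f)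
    (f : D φ M) : P f := by
  have hle : NonUnitalStarAlgebra.adjoin ℂ {f | ∃ (h : H) (n : N), f = cosetFun φ M h n} ≤
      tameSub φ M := by
    refine NonUnitalStarAlgebra.adjoin_le ?_
    rintro _ ⟨h, n, rfl⟩
    exact exists_isTame_cosetFun hfilter hcover h n
  have hf : f.1 ∈ closure ((NonUnitalStarAlgebra.adjoin ℂ
    {f | ∃ (h : H) (n : N), f = cosetFun φ M h n} : NonUnitalStarSubalgebra ℂ _) : Set _) := f.2
  have hmem : f ∈ closure {g : D φ M | P g} := by
    -- `D` carries the norm of `ℓ^∞(N)`, so a closure in `D` can be computed in `ℓ^∞(N)`.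
    rw [isometry_val.isUniformInducing.isInducing.closure_eq_preimage_closure_image]
    refine closure_mono ?_ hf
    intro g hg
    obtain ⟨c, hc⟩ := hle hg
    exact ⟨⟨g, NonUnitalStarSubalgebra.le_topologicalClosure _ hg⟩, htame c _ hc, rfl⟩
  rwa [hcl.closure_eq] at hmem

theorem D.ext {f g : D φ M} (h : ∀ n, f.1 n = g.1 n) : f = g :=
  Subtype.ext (lp.ext (funext h))

theorem D.mul_comm' (f g : D φ M) : f * g = g * f :=
  D.ext fun n => mul_comm (f.1 n) (g.1 n)

theorem action_apply (h : H) (f : D φ M) (n : N) : (action φ M h f).1 n = f.1 (φ h⁻¹ n) := rfl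

theorem action_cosetD (g h : H) (n : N) :
    action φ M g (cosetD φ M h n) = cosetD φ M (g * h) (φ g n) :=
  Subtype.ext (translate_cosetFun φ M g h n)

theorem action_cosetD_one (g h : H) :
    action φ M g (cosetD φ M h 1) = cosetD φ M (g * h) 1 := by
  rw [action_cosetD, map_one]

theorem norm_action_le (h : H) (f : D φ M) : ‖action φ M h f‖ ≤ ‖f‖ :=
  NonUnitalStarAlgHom.norm_apply_le _ _

theorem IsTame.action {c : H} {f : D φ M} (hf : IsTame φ M c f.1) (a : HPlus φ M) (n x : N)
    (hx : x ∈ conj φ M (a * c)) : (action φ M a f).1 (n * x) = (action φ M a f).1 n := by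
  rw [action_apply, action_apply, map_mul]
  refine hf.invariant _ _ ?_
  rwa [apply_mem_conj, inv_inv]

variable (φ M) in
/-- The filter of tails of `H⁺`, directed by divisibility. -/
def tails : Filter (HPlus φ M) := ⨅ b : HPlus φ M, 𝓟 {a | b ∣ a}

instance : (tails φ M).NeBot := by
  refine iInf_neBot_of_directed (fun a b => ⟨a * b, ?_, ?_⟩)
    fun b => principal_neBot_iff.2 ⟨b, dvd_rfl⟩
  · exact principal_mono.2 fun c hc => (dvd_mul_right a b).trans hc
  · exact principal_mono.2 fun c hc => (dvd_mul_left b a).trans hc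

theorem eventually_dvd (b : HPlus φ M) : ∀ᶠ a in tails φ M, b ∣ a :=
  mem_iInf_of_mem b (mem_principal_self _)

end Tame

end AxPlusB

/-- Compressing the sum by `p j` gives `p j = ∑ p j p k p j`. The term `k = j` is already `p j`, so
the remaining terms, each of the form `x^* x` with `x = p k p j`, are positive with sum zero and
therefore vanish. -/
theorem IsStarProjection.mul_eq_zero_of_sum_eq_one {B ι : Type*} [CStarAlgebra B] [Fintype ι]
    {p : ι → B} (hp : ∀ i, IsStarProjection (p i)) (hsum : ∑ i, p i = 1) {i j : ι} (hij : i ≠ j) :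
    p i * p j = 0 := by
  classical
  let _ := CStarAlgebra.spectralOrder B
  have := CStarAlgebra.spectralOrderedRing B
  have hterm : ∀ k, p j * p k * p j = star (p k * p j) * (p k * p j) := fun k => by
    rw [star_mul, (hp k).isSelfAdjoint.star_eq, (hp j).isSelfAdjoint.star_eq, mul_assoc (p j),
      mul_assoc (p j), ← mul_assoc (p k) (p k), (hp k).isIdempotentElem.eq]
  have h1 : ∑ k, p j * p k * p j = p j := by
    rw [← Finset.sum_mul, ← Finset.mul_sum, hsum, mul_one, (hp j).isIdempotentElem.eq]
  rw [← Finset.add_sum_erase _ _ (Finset.mem_univ j), (hp j).isIdempotentElem.eq,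
    (hp j).isIdempotentElem.eq, add_eq_left] at h1
  have h2 := (Finset.sum_eq_zero_iff_of_nonneg fun k _ => by
    rw [hterm]; exact star_mul_self_nonneg _).1 h1 i (Finset.mem_erase.2 ⟨hij, Finset.mem_univ i⟩)
  rw [hterm] at h2
  exact CStarRing.star_mul_self_eq_zero_iff _ |>.1 h2

/-! ### Orthogonality in an SP-family and the representation `ρ` of `D`. -/

namespace AxPlusB

open scoped Pointwise
open Filter Topology

section Family

variable {N H : Type*} [Group N] [CommGroup H] {φ : H →* MulAut N} {M : Subgroup N}

/-- The coset space `M / c M c⁻¹`. -/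
abbrev Cosets (c : HPlus φ M) := M ⧸ (conj φ M (c : H)).subgroupOf M

variable {B : Type*} [CStarAlgebra B] {S : HPlus φ M → B} {P : HPlus φ M → M → B}

theorem Cosets.out_mem {c : HPlus φ M} (x : Cosets c) (m : M) (hx : (m : Cosets c) = x) :
    (m : N)⁻¹ * x.out ∈ conj φ M (c : H) := by
  have := QuotientGroup.eq.1 (hx.trans x.out_eq.symm)
  exact this

namespace IsSPFamily

/-- The summation relation with `b = e` has a single coset, which any element of `M` may represent.
The representative `c⁻¹(m⁻¹m')c` turns the one summand into `P(c,m')`. -/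
theorem P_congr (h : IsSPFamily S P) (c : HPlus φ M) {m m' : M}
    (hm : (m : N)⁻¹ * m' ∈ conj φ M (c : H)) : P c m = P c m' := by
  have hj : φ (c : H)⁻¹ ((m : N)⁻¹ * m') ∈ M := mem_conj.1 hm
  have := h.p_sum c 1 m {⟨_, hj⟩} (by
    rw [Finset.coe_singleton, Subgroup.isComplement_singleton_left, Submonoid.coe_one, conj_one,
      Subgroup.subgroupOf_self, Subgroup.coe_top])
  rw [this, Finset.sum_singleton, mul_one]
  congr 1
  refine Subtype.ext ?_
  change (m : N) * φ c (φ (c : H)⁻¹ ((m : N)⁻¹ * m')) = m'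
  rw [map_inv, MulAut.apply_inv_self, mul_inv_cancel_left]

theorem P_mul_self (h : IsSPFamily S P) (c : HPlus φ M) (m : M) : P c m * P c m = P c m :=
  (h.projection c m).isIdempotentElem.eq

theorem star_P (h : IsSPFamily S P) (c : HPlus φ M) (m : M) : star (P c m) = P c m :=
  (h.projection c m).isSelfAdjoint.star_eq

variable [∀ c : HPlus φ M, Fintype (Cosets c)]

theorem P_eq_sum_out (h : IsSPFamily S P) (a b : HPlus φ M) (k : M) :
    P a k = ∑ x : Cosets b, P (a * b) (k * conjM a x.out) := by
  classical
  have := h.p_sum a b k (Finset.univ.image fun x : Cosets b => x.out) (by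
    rw [Finset.coe_image, Finset.coe_univ, Set.image_univ]
    exact Subgroup.isComplement_range_left fun q => q.out_eq)
  exact this.trans (Finset.sum_image fun x _ y _ hxy => Quotient.out_injective hxy)

theorem sum_P_out (h : IsSPFamily S P) (c : HPlus φ M) : ∑ x : Cosets c, P c x.out = 1 := by
  rw [← h.p_one, h.P_eq_sum_out 1 c 1, one_mul]
  refine Finset.sum_congr rfl fun x _ => ?_
  congr 1
  refine Subtype.ext ?_
  change _ = 1 * φ ((1 : HPlus φ M) : H) x.out
  rw [Submonoid.coe_one, map_one, one_mul, MulAut.one_apply]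

theorem P_mul_P_of_notMem (h : IsSPFamily S P) (c : HPlus φ M) {m m' : M}
    (hm : (m : N)⁻¹ * m' ∉ conj φ M (c : H)) : P c m * P c m' = 0 := by
  rw [h.P_congr c (Cosets.out_mem (m : Cosets c) m rfl),
    h.P_congr c (Cosets.out_mem (m' : Cosets c) m' rfl)]
  refine IsStarProjection.mul_eq_zero_of_sum_eq_one (fun x : Cosets c => h.projection c x.out)
    (h.sum_P_out c) fun he : (m : Cosets c) = m' => hm ?_
  have hmem : m⁻¹ * m' ∈ (conj φ M (c : H)).subgroupOf M := QuotientGroup.eq.1 he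
  exact hmem

/-- This is `P(cd,m) ≤ P(c,m)`: in the expansion of `P(c,m)` at level `cd` only the summand of the
trivial coset meets `P(cd,m)`; the rest are orthogonal to it. -/
theorem P_mul_P_mul (h : IsSPFamily S P) (c d : HPlus φ M) (m : M) :
    P (c * d) m * P c m = P (c * d) m := by
  classical
  rw [h.P_eq_sum_out c d m, Finset.mul_sum,
    Finset.sum_eq_single (QuotientGroup.mk (1 : M) : Cosets d)]
  · rw [h.P_congr (c * d) (m := m), h.P_mul_self]
    have := Cosets.out_mem (QuotientGroup.mk (1 : M) : Cosets d) 1 rfl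
    rw [Submonoid.coe_mul]
    change (m : N)⁻¹ * (m * φ c _) ∈ _
    rw [inv_mul_cancel_left, apply_mem_conj, inv_mul_cancel_left]
    simpa using this
  · intro x _ hx
    refine h.P_mul_P_of_notMem _ fun hm => hx ?_
    rw [Submonoid.coe_mul] at hm
    change (m : N)⁻¹ * (m * φ c _) ∈ _ at hm
    rw [inv_mul_cancel_left, apply_mem_conj, inv_mul_cancel_left] at hm
    rw [← x.out_eq]
    refine (QuotientGroup.eq.2 ?_).symm
    rw [inv_one, one_mul]
    exact hm
  · exact fun hx => absurd (Finset.mem_univ _) hx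

theorem eq_of_forall_mul_P (h : IsSPFamily S P) (c : HPlus φ M) {x y : B}
    (hxy : ∀ m, x * P c m = y * P c m) : x = y := by
  rw [← mul_one x, ← mul_one y, ← h.sum_P_out c, Finset.mul_sum, Finset.mul_sum]
  exact Finset.sum_congr rfl fun _ _ => hxy _

theorem mul_eq_sum (h : IsSPFamily S P) (c : HPlus φ M) (x : B) :
    x = ∑ y : Cosets c, x * P c y.out := by
  rw [← Finset.mul_sum, h.sum_P_out, mul_one]

/-- The Riemann sums `∑ f(m) P(c, m)` over `M / c M c⁻¹`. -/
noncomputable def riemannSum (h : IsSPFamily S P) (c : HPlus φ M) : D φ M →⋆ₙₐ[ℂ] B where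
  toFun f := ∑ x : Cosets c, f.1 x.out • P c x.out
  map_smul' r f := by
    rw [Finset.smul_sum]
    exact Finset.sum_congr rfl fun x _ => mul_smul r (f.1 x.out) _
  map_zero' := Finset.sum_eq_zero fun x _ => zero_smul ℂ _
  map_add' f g := by
    rw [← Finset.sum_add_distrib]
    exact Finset.sum_congr rfl fun x _ => add_smul (f.1 x.out) (g.1 x.out) _
  map_mul' f g := by
    rw [Finset.sum_mul]
    refine Finset.sum_congr rfl fun x _ => ?_
    -- Orthogonality of the `P(c,·)` for distinct cosets removes the cross terms.
    rw [Finset.mul_sum, Finset.sum_eq_single x]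
    · rw [smul_mul_smul_comm, h.P_mul_self]; rfl
    · intro y _ hy
      rw [smul_mul_smul_comm, IsStarProjection.mul_eq_zero_of_sum_eq_one
        (fun x : Cosets c => h.projection c x.out) (h.sum_P_out c) hy.symm, smul_zero]
    · exact fun hx => absurd (Finset.mem_univ _) hx
  map_star' f := by
    rw [star_sum]
    refine Finset.sum_congr rfl fun x _ => ?_
    rw [star_smul, h.star_P]; rfl

/-- A cell at the finer level `e` either lies in the coset of `k`, where `f` has the constant value
`f(k)`, or lies under some `P(c,m)` orthogonal to `P(c,k)` and contributes nothing. -/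
theorem riemannSum_mul_P (h : IsSPFamily S P) {c e : HPlus φ M} (hce : c ∣ e) {f : D φ M}
    (hf : ∀ n, ∀ x ∈ conj φ M (c : H), f.1 (n * x) = f.1 n) (k : M) :
    h.riemannSum e f * P c k = f.1 k • P c k := by
  obtain ⟨d, rfl⟩ := hce
  change (∑ x : Cosets (c * d), f.1 x.out • P (c * d) x.out) * P c k = _
  have hk : f.1 k • P c k = ∑ x : Cosets (c * d), f.1 k • (P (c * d) x.out * P c k) := by
    rw [← Finset.smul_sum, ← Finset.sum_mul, h.sum_P_out, one_mul]
  rw [hk, Finset.sum_mul]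
  refine Finset.sum_congr rfl fun x _ => ?_
  rw [smul_mul_assoc]
  by_cases hx : (k : N)⁻¹ * x.out ∈ conj φ M (c : H)
  · congr 1
    rw [← hf k _ hx, mul_inv_cancel_left]
  · have hx' : (x.out : N)⁻¹ * k ∉ conj φ M (c : H) := fun hx' => hx (by
      simpa using inv_mem hx')
    rw [← h.P_mul_P_mul c d, mul_assoc, h.P_mul_P_of_notMem c hx', mul_zero, smul_zero, smul_zero]

theorem riemannSum_eq (h : IsSPFamily S P) {c e : HPlus φ M} (hce : c ∣ e) {f : D φ M}
    (hf : ∀ n, ∀ x ∈ conj φ M (c : H), f.1 (n * x) = f.1 n) :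
    h.riemannSum e f = h.riemannSum c f :=
  h.eq_of_forall_mul_P c fun m => by
    rw [h.riemannSum_mul_P hce hf, h.riemannSum_mul_P dvd_rfl hf]

/-- On tame functions the sums are eventually constant along `tails`. Being *-homomorphisms they are
contractive uniformly in `c`, so convergence passes to norm limits by an `ε/3` argument. -/
theorem exists_tendsto_riemannSum (h : IsSPFamily S P)
    (hfilter : ∀ a b : H, ∃ c : H, conj φ M c ≤ conj φ M a ⊓ conj φ M b)
    (hcover : ∀ n : N, ∃ a ∈ HPlus φ M, n ∈ conj φ M a⁻¹) (f : D φ M) :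
    ∃ x, Tendsto (fun c => h.riemannSum c f) (tails φ M) (𝓝 x) := by
  suffices hc : Cauchy (map (fun c => h.riemannSum c f) (tails φ M)) from
    CompleteSpace.complete hc
  refine D.induction_tame hfilter hcover
    (P := fun f => Cauchy (map (fun c => h.riemannSum c f) (tails φ M))) ?_ ?_ f
  · rw [← isSeqClosed_iff_isClosed]
    intro u f hu hf
    refine Metric.cauchy_iff.2 ⟨inferInstance, fun ε hε => ?_⟩
    obtain ⟨n, hn⟩ := ((Metric.tendsto_nhds.1 hf) (ε / 3) (by positivity)).exists
    obtain ⟨t, ht, hdist⟩ := (Metric.cauchy_iff.1 (hu n)).2 (ε / 3) (by positivity)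
    refine ⟨_, image_mem_map (mem_map.1 ht), ?_⟩
    have hclose : ∀ c, dist (h.riemannSum c f) (h.riemannSum c (u n)) < ε / 3 := fun c => by
      rw [dist_eq_norm, ← map_sub]
      refine (NonUnitalStarAlgHom.norm_apply_le _ _).trans_lt ?_
      rwa [← dist_eq_norm, dist_comm]
    rintro _ ⟨c, hc, rfl⟩ _ ⟨d, hd, rfl⟩
    have h1 := hclose c
    have h2 := hclose d
    have h3 := hdist _ hc _ hd
    have h4 := dist_triangle4 (h.riemannSum c f) (h.riemannSum c (u n)) (h.riemannSum d (u n))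
      (h.riemannSum d f)
    rw [dist_comm] at h2
    linarith
  · intro c f hf
    refine Tendsto.cauchy_map (tendsto_const_nhds.congr' ?_ :
      Tendsto _ _ (𝓝 (h.riemannSum c f)))
    filter_upwards [eventually_dvd c] with e he
    exact (h.riemannSum_eq he hf.invariant).symm

/-- The limit inherits all algebraic operations from the Riemann sums. Its values on the cells
`P(c,k)` are all that is used later, as these cells sum to `1` and so detect equality in `B`. -/
theorem exists_rho (h : IsSPFamily S P)
    (hfilter : ∀ a b : H, ∃ c : H, conj φ M c ≤ conj φ M a ⊓ conj φ M b)
    (hcover : ∀ n : N, ∃ a ∈ HPlus φ M, n ∈ conj φ M a⁻¹) :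
    ∃ ρ : D φ M →⋆ₙₐ[ℂ] B, ∀ (c : HPlus φ M) (f : D φ M),
      (∀ n, ∀ x ∈ conj φ M (c : H), f.1 (n * x) = f.1 n) →
        ∀ k, ρ f * P c k = f.1 k • P c k := by
  choose ρ hρ using h.exists_tendsto_riemannSum hfilter hcover
  refine ⟨⟨⟨⟨⟨ρ, fun r f => ?_⟩, ?_, fun f g => ?_⟩, fun f g => ?_⟩, fun f => ?_⟩, fun c f hf k => ?_⟩
  · refine tendsto_nhds_unique (hρ _) (((hρ f).const_smul r).congr fun c => ?_)
    exact (map_smul _ r f).symm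
  · refine tendsto_nhds_unique (hρ _) (tendsto_const_nhds.congr fun c => ?_)
    exact (map_zero _).symm
  · exact tendsto_nhds_unique (hρ _) (((hρ f).add (hρ g)).congr fun c => (map_add _ f g).symm)
  · exact tendsto_nhds_unique (hρ _) (((hρ f).mul (hρ g)).congr fun c => (map_mul _ f g).symm)
  · exact tendsto_nhds_unique (hρ _) ((hρ f).star.congr fun c => (map_star _ f).symm)
  · refine tendsto_nhds_unique ((hρ f).mul_const _) (tendsto_const_nhds.congr' ?_)
    filter_upwards [eventually_dvd c] with e he
    exact (h.riemannSum_mul_P he hf k).symm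

end IsSPFamily

end Family

end AxPlusB

/-! ### The partial isometries `V_g` and their relations with `ρ`. -/

namespace AxPlusB

open scoped Pointwise
open Filter Topology

section Covariant

variable {N H : Type*} [Group N] [CommGroup H] {φ : H →* MulAut N} {M : Subgroup N}
variable {B : Type*} [CStarAlgebra B] {S : HPlus φ M → B} {P : HPlus φ M → M → B}

theorem continuous_starHom {A A' : Type*} [NonUnitalCStarAlgebra A] [NonUnitalCStarAlgebra A']
    (ψ : A →⋆ₙₐ[ℂ] A') : Continuous ψ :=
  AddMonoidHomClass.continuous_of_bound ψ 1 fun a => by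
    rw [one_mul]; exact NonUnitalStarAlgHom.norm_apply_le ψ a

/-- A homomorphism `ρ` of `D` extending `P`, and partial isometries `V` indexed by `H` extending
`S`. -/
structure IsExtension (S : HPlus φ M → B) (P : HPlus φ M → M → B) (ρ : D φ M →⋆ₙₐ[ℂ] B)
    (V : H → B) : Prop where
  rho_mul_P : ∀ (c : HPlus φ M) (f : D φ M),
    (∀ n, ∀ x ∈ conj φ M (c : H), f.1 (n * x) = f.1 n) → ∀ k, ρ f * P c k = f.1 k • P c k
  V_eq : ∀ (g : H) (b c : HPlus φ M), (c : H) * g = b → V g = star (S c) * S b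

namespace IsSPFamily

theorem S_mul_star (h : IsSPFamily S P) (a : HPlus φ M) : S a * star (S a) = P a 1 := by
  have := h.s_p a 1 1
  rw [h.p_one, mul_one, mul_one] at this
  rw [this]
  congr 1
  exact Subtype.ext (map_one _)

theorem S_mul_P (h : IsSPFamily S P) (a b : HPlus φ M) (m : M) :
    S a * P b m = P (a * b) (conjM a m) * S a := by
  rw [← h.s_p, mul_assoc, h.isometry, mul_one]

theorem S_comm (h : IsSPFamily S P) (a b : HPlus φ M) : S a * S b = S b * S a := by
  rw [h.s_mul, h.s_mul, mul_comm]

theorem star_S_comm (h : IsSPFamily S P) (a b : HPlus φ M) :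
    star (S a) * star (S b) = star (S b) * star (S a) := by
  rw [← star_mul, ← star_mul, h.S_comm]

/-- Cancellation of a common factor, by `S_a^* S_a = 1`; this makes `S_c^* S_b` depend only on the
fraction `c⁻¹b`. -/
theorem star_S_mul_S (h : IsSPFamily S P) (a b c : HPlus φ M) :
    star (S (a * c)) * S (a * b) = star (S c) * S b := by
  rw [← h.s_mul, ← h.s_mul, star_mul, mul_assoc, ← mul_assoc (star (S a)), h.isometry, one_mul]

theorem norm_S_le (h : IsSPFamily S P) (a : HPlus φ M) : ‖S a‖ ≤ 1 := by
  rcases subsingleton_or_nontrivial B with hB | hB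
  · rw [Subsingleton.elim (S a) 0, norm_zero]
    exact zero_le_one
  · have := CStarRing.norm_star_mul_self (x := S a)
    rw [h.isometry, CStarRing.norm_one] at this
    nlinarith [norm_nonneg (S a)]

theorem exists_V (h : IsSPFamily S P)
    (hfilter : ∀ a b : H, ∃ c : H, conj φ M c ≤ conj φ M a ⊓ conj φ M b) :
    ∃ V : H → B, ∀ (g : H) (b c : HPlus φ M), (c : H) * g = b → V g = star (S c) * S b := by
  choose b c hbc using exists_mul_mem_HPlus (φ := φ) (M := M) hfilter
  refine ⟨fun g => star (S (c g)) * S (b g), fun g b' c' hg => ?_⟩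
  have e : c' * b g = c g * b' := Subtype.ext (by
    rw [Submonoid.coe_mul, Submonoid.coe_mul, ← hg, ← hbc, mul_left_comm])
  change star (S (c g)) * S (b g) = _
  -- Both fractions are expanded to the common denominator `c(g) c'`.
  rw [← h.star_S_mul_S c', e, mul_comm c', h.star_S_mul_S]

end IsSPFamily

namespace IsExtension

variable {ρ : D φ M →⋆ₙₐ[ℂ] B} {V : H → B}

theorem V_coe (hE : IsExtension S P ρ V) (h : IsSPFamily S P) (a : HPlus φ M) : V a = S a := by
  have h1 : S 1 = 1 := by
    have h11 := h.s_mul 1 1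
    rw [mul_one] at h11
    rw [← one_mul (S 1), ← h.isometry 1, mul_assoc, h11]
  rw [hE.V_eq a a 1 (one_mul _), h1, star_one, one_mul]

theorem star_V (hE : IsExtension S P ρ V)
    (hfilter : ∀ a b : H, ∃ c : H, conj φ M c ≤ conj φ M a ⊓ conj φ M b) (g : H) :
    star (V g) = V g⁻¹ := by
  obtain ⟨b, c, hbc⟩ := exists_mul_mem_HPlus hfilter g
  rw [hE.V_eq g b c hbc, hE.V_eq g⁻¹ c b (by rw [← hbc, mul_inv_cancel_right]), star_mul, star_star]

/-- A Toeplitz-type invariance: since `H⁺` is commutative, `S_a^* S_c^* S_b S_a` is again the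
fraction `(ac)⁻¹(ab)`. -/
theorem star_S_mul_V_mul_S (hE : IsExtension S P ρ V) (h : IsSPFamily S P)
    (hfilter : ∀ a b : H, ∃ c : H, conj φ M c ≤ conj φ M a ⊓ conj φ M b) (a : HPlus φ M) (g : H) :
    star (S a) * V g * S a = V g := by
  obtain ⟨b, c, hbc⟩ := exists_mul_mem_HPlus hfilter g
  rw [hE.V_eq g b c hbc, ← mul_assoc, mul_assoc, h.S_comm b a, h.star_S_comm, ← star_mul,
    h.s_mul, h.s_mul, h.star_S_mul_S]

theorem norm_V_le (hE : IsExtension S P ρ V) (h : IsSPFamily S P)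
    (hfilter : ∀ a b : H, ∃ c : H, conj φ M c ≤ conj φ M a ⊓ conj φ M b) (g : H) :
    ‖V g‖ ≤ 1 := by
  obtain ⟨b, c, hbc⟩ := exists_mul_mem_HPlus hfilter g
  rw [hE.V_eq g b c hbc]
  refine (norm_mul_le _ _).trans (mul_le_one₀ ?_ (norm_nonneg _) (h.norm_S_le b))
  rw [norm_star]
  exact h.norm_S_le c

variable [∀ c : HPlus φ M, Fintype (Cosets c)]

theorem rho_cosetD (hE : IsExtension S P ρ V) (h : IsSPFamily S P) (a : HPlus φ M) (m : M) :
    ρ (cosetD φ M a m) = P a m := by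
  refine h.eq_of_forall_mul_P a fun k => ?_
  rw [hE.rho_mul_P a _ fun n x hx => cosetFun_mul_right hx]
  by_cases hk : (m : N)⁻¹ * k ∈ conj φ M (a : H)
  · rw [h.P_congr a hk, h.P_mul_self]
    erw [cosetFun_apply_of_mem hk]
    exact one_smul ℂ _
  · rw [h.P_mul_P_of_notMem a hk]
    erw [cosetFun_apply_of_notMem hk]
    exact zero_smul ℂ _

theorem rho_cosetD_one (hE : IsExtension S P ρ V) (h : IsSPFamily S P) (a : HPlus φ M) :
    ρ (cosetD φ M a 1) = S a * star (S a) := by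
  rw [h.S_mul_star]
  exact hE.rho_cosetD h a 1

/-- For tame `f` of level `c`, both sides can be tested on the cells `P(c,m)`. Moving `S_a` across
turns the cell into `P(ac, ama⁻¹)`, on which `α_a(f)` takes the value `f(m)`. -/
theorem S_mul_rho (hE : IsExtension S P ρ V) (h : IsSPFamily S P)
    (hfilter : ∀ a b : H, ∃ c : H, conj φ M c ≤ conj φ M a ⊓ conj φ M b)
    (hcover : ∀ n : N, ∃ a ∈ HPlus φ M, n ∈ conj φ M a⁻¹) (a : HPlus φ M) (f : D φ M) :
    S a * ρ f = ρ (action φ M a f) * S a := by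
  refine D.induction_tame hfilter hcover (P := fun f => S a * ρ f = ρ (action φ M a f) * S a)
    ?_ ?_ f
  · exact isClosed_eq (continuous_const.mul (continuous_starHom ρ))
      ((continuous_starHom (ρ.comp (action φ M a))).mul continuous_const)
  · intro c f hf
    refine h.eq_of_forall_mul_P c fun m => ?_
    rw [mul_assoc, hE.rho_mul_P c f hf.invariant, mul_assoc, h.S_mul_P, ← mul_assoc,
      hE.rho_mul_P (a * c) _ (hf.action a), mul_smul_comm, h.S_mul_P, smul_mul_assoc]
    congr 1
    rw [action_apply]
    change f.1 m = f.1 (φ (a : H)⁻¹ (φ a m))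
    rw [map_inv, MulAut.inv_apply_self]

theorem rho_mul_star_S (hE : IsExtension S P ρ V) (h : IsSPFamily S P)
    (hfilter : ∀ a b : H, ∃ c : H, conj φ M c ≤ conj φ M a ⊓ conj φ M b)
    (hcover : ∀ n : N, ∃ a ∈ HPlus φ M, n ∈ conj φ M a⁻¹) (a : HPlus φ M) (f : D φ M) :
    ρ f * star (S a) = star (S a) * ρ (action φ M a f) := by
  have := congrArg star (hE.S_mul_rho h hfilter hcover a (star f))
  rwa [star_mul, star_mul, ← map_star, star_star, ← map_star, ← map_star, star_star] at this

theorem V_mul_rho (hE : IsExtension S P ρ V) (h : IsSPFamily S P)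
    (hfilter : ∀ a b : H, ∃ c : H, conj φ M c ≤ conj φ M a ⊓ conj φ M b)
    (hcover : ∀ n : N, ∃ a ∈ HPlus φ M, n ∈ conj φ M a⁻¹) (g : H) (f : D φ M) :
    V g * ρ f = ρ (action φ M g f) * V g := by
  obtain ⟨b, c, hbc⟩ := exists_mul_mem_HPlus hfilter g
  rw [hE.V_eq g b c hbc, mul_assoc, hE.S_mul_rho h hfilter hcover, ← mul_assoc, ← mul_assoc,
    hE.rho_mul_star_S h hfilter hcover, ← ConvAlgebra.act_mul, hbc]

/-- With `g = c⁻¹b` and `k = e⁻¹d`, inserting `S_b^* S_b = 1` in the middle and commuting the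
adjoints produces the range projection `S_b S_b^* = ρ(χ_{bMb⁻¹})`. Pulling it to the left across
`S_c^*` turns it into `ρ(χ_{gMg⁻¹})`. -/
theorem V_mul_V (hE : IsExtension S P ρ V) (h : IsSPFamily S P)
    (hfilter : ∀ a b : H, ∃ c : H, conj φ M c ≤ conj φ M a ⊓ conj φ M b)
    (hcover : ∀ n : N, ∃ a ∈ HPlus φ M, n ∈ conj φ M a⁻¹) (g k : H) :
    V g * V k = ρ (cosetD φ M g 1) * V (g * k) := by
  obtain ⟨b, c, hbc⟩ := exists_mul_mem_HPlus hfilter g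
  obtain ⟨d, e, hde⟩ := exists_mul_mem_HPlus hfilter k
  rw [hE.V_eq g b c hbc, hE.V_eq k d e hde, hE.V_eq (g * k) (b * d) (c * e) (by
    rw [Submonoid.coe_mul, Submonoid.coe_mul, ← hbc, ← hde]; exact mul_mul_mul_comm _ _ _ _)]
  have h1 : ρ (cosetD φ M g 1) * star (S c) = star (S c) * (S b * star (S b)) := by
    rw [hE.rho_mul_star_S h hfilter hcover, action_cosetD_one, hbc, hE.rho_cosetD_one h]
  calc star (S c) * S b * (star (S e) * S d)
      = star (S c) * S b * (star (S e) * (star (S b) * S b) * S d) := by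
        rw [h.isometry, mul_one]
    _ = star (S c) * S b * ((star (S b) * star (S e)) * S b * S d) := by
        rw [← mul_assoc (star (S e)), h.star_S_comm e b]
    _ = (star (S c) * (S b * star (S b))) * (star (S e) * (S b * S d)) := by
        simp only [mul_assoc]
    _ = _ := by
        rw [← h1, ← h.s_mul b d, ← h.s_mul c e, h.S_comm c e, star_mul]
        simp only [mul_assoc]

end IsExtension

/-- Multiplication by the translates of `χ_M` by `a⁻¹ g` tends to the identity as `a` grows. -/
theorem tendsto_mul_cosetD
    (hfilter : ∀ a b : H, ∃ c : H, conj φ M c ≤ conj φ M a ⊓ conj φ M b)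
    (hcover : ∀ n : N, ∃ a ∈ HPlus φ M, n ∈ conj φ M a⁻¹) (g : H) (f : D φ M) :
    Tendsto (fun a : HPlus φ M => f * cosetD φ M ((a : H)⁻¹ * g) 1) (tails φ M) (𝓝 f) := by
  have hnorm : ∀ g : H, ‖cosetD φ M g 1‖ ≤ 1 := fun g =>
    lp.norm_le_of_forall_le zero_le_one fun x => by
      by_cases hx : (1 : N)⁻¹ * x ∈ conj φ M g
      · change ‖cosetFun φ M g 1 x‖ ≤ 1
        rw [cosetFun_apply_of_mem hx, norm_one]
      · change ‖cosetFun φ M g 1 x‖ ≤ 1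
        rw [cosetFun_apply_of_notMem hx, norm_zero]; exact zero_le_one
  refine D.induction_tame hfilter hcover (P := fun f => Tendsto
    (fun a : HPlus φ M => f * cosetD φ M ((a : H)⁻¹ * g) 1) (tails φ M) (𝓝 f)) ?_ ?_ f
  -- The multipliers are contractive uniformly in `a`, so the property is closed.
  · rw [← isSeqClosed_iff_isClosed]
    intro u f hu hf
    refine Metric.tendsto_nhds.2 fun ε hε => ?_
    obtain ⟨n, hn⟩ := ((Metric.tendsto_nhds.1 hf) (ε / 3) (by positivity)).exists
    filter_upwards [Metric.tendsto_nhds.1 (hu n) (ε / 3) (by positivity)] with a ha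
    have h1 : dist (f * cosetD φ M ((a : H)⁻¹ * g) 1) (u n * cosetD φ M ((a : H)⁻¹ * g) 1) ≤
        dist f (u n) := by
      rw [dist_eq_norm, dist_eq_norm, ← sub_mul]
      exact (norm_mul_le _ _).trans (mul_le_of_le_one_right (norm_nonneg _) (hnorm _))
    have h4 := dist_triangle4 (f * cosetD φ M ((a : H)⁻¹ * g) 1)
      (u n * cosetD φ M ((a : H)⁻¹ * g) 1) (u n) f
    rw [dist_comm f] at h1
    linarith
  · intro c f hf
    obtain ⟨b, d, hbd⟩ := exists_mul_mem_HPlus hfilter g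
    refine tendsto_const_nhds.congr' ?_
    -- If `a = cbe` and `dg = b`, then `g⁻¹ a c⁻¹ = de ∈ H⁺`. So the conjugate of `M` by `a⁻¹g`
    -- contains `c⁻¹Mc`, hence the support of `f`, and the product equals `f`.
    filter_upwards [eventually_dvd (c * b)] with a ha
    obtain ⟨e, rfl⟩ := ha
    refine D.ext fun n => ?_
    change f.1 n = f.1 n * cosetFun φ M _ 1 n
    by_cases h0 : f.1 n = 0
    · rw [h0, zero_mul]
    · rw [cosetFun_apply_of_mem, mul_one]
      rw [inv_one, one_mul]
      refine (conj_le_conj.2 ?_ : conj φ M (c : H)⁻¹ ≤ _) (hf.support n h0)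
      have : (((c * b * e : HPlus φ M) : H)⁻¹ * g)⁻¹ * (c : H)⁻¹ = (d * e : HPlus φ M) := by
        have e1 : (c : H) * (d * g) * e = g * ((d * e) * c) := by ac_rfl
        rw [Submonoid.coe_mul, Submonoid.coe_mul, Submonoid.coe_mul, ← hbd, mul_inv_rev, inv_inv,
          e1, inv_mul_cancel_left, mul_inv_cancel_right]
      rw [this]
      exact (d * e).2

end Covariant

end AxPlusB

/-! ### Asymptotic multiplicativity of `θ_a` and the norm estimate. -/

namespace AxPlusB

open scoped Pointwise
open Filter Topology

section Theta

variable {N H : Type*} [Group N] [CommGroup H] {φ : H →* MulAut N} {M : Subgroup N}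
variable {B : Type*} [CStarAlgebra B] {S : HPlus φ M → B} {P : HPlus φ M → M → B}
variable {ρ : D φ M →⋆ₙₐ[ℂ] B} {V : H → B}

/-- The linear map `∑ f_g g ↦ ∑ ρ(α_a(f_g)) V_g` on `C_c(H, D)`. -/
noncomputable def theta (ρ : D φ M →⋆ₙₐ[ℂ] B) (V : H → B) (a : H) :
    ConvAlgebra (action φ M) →ₗ[ℂ] B :=
  (Finsupp.lsum ℂ fun g =>
    { toFun := fun f => ρ (action φ M a f) * V g
      map_add' := fun f f' => by rw [map_add, map_add, add_mul]
      map_smul' := fun r f => by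
        rw [map_smul, map_smul, smul_mul_assoc]; rfl } : (H →₀ D φ M) →ₗ[ℂ] B)

theorem theta_single (a g : H) (f : D φ M) :
    theta ρ V a (.single (action φ M) g f) = ρ (action φ M a f) * V g :=
  Finsupp.sum_single_index (map_zero _)

theorem theta_one_single (g : H) (f : D φ M) :
    theta ρ V 1 (.single (action φ M) g f) = ρ f * V g := by
  rw [theta_single, map_one]; rfl

theorem norm_theta_le (hV : ∀ g, ‖V g‖ ≤ 1) (a : H) (F : ConvAlgebra (action φ M)) :
    ‖theta ρ V a F‖ ≤ F.l1Norm := by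
  refine (norm_sum_le _ _).trans (Finset.sum_le_sum fun g _ => ?_)
  refine (norm_mul_le _ _).trans ((mul_le_of_le_one_right (norm_nonneg _) (hV g)).trans ?_)
  exact (NonUnitalStarAlgHom.norm_apply_le _ _).trans (norm_action_le _ _)

namespace IsExtension

theorem star_S_mul_theta_mul_S [∀ c : HPlus φ M, Fintype (Cosets c)]
    (hE : IsExtension S P ρ V) (h : IsSPFamily S P)
    (hfilter : ∀ a b : H, ∃ c : H, conj φ M c ≤ conj φ M a ⊓ conj φ M b)
    (hcover : ∀ n : N, ∃ a ∈ HPlus φ M, n ∈ conj φ M a⁻¹) (a : HPlus φ M)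
    (F : ConvAlgebra (action φ M)) :
    star (S a) * theta ρ V a F * S a = theta ρ V 1 F := by
  induction F using ConvAlgebra.induction with
  | zero => simp
  | add F G hF hG => rw [map_add, map_add, mul_add, add_mul, hF, hG]
  | single g f =>
    rw [theta_single, theta_one_single, ← mul_assoc, ← hE.rho_mul_star_S h hfilter hcover,
      mul_assoc, mul_assoc, ← mul_assoc (star (S a)), hE.star_S_mul_V_mul_S h hfilter]

variable [∀ c : HPlus φ M, Fintype (Cosets c)]

theorem theta_star (hE : IsExtension S P ρ V) (h : IsSPFamily S P)
    (hfilter : ∀ a b : H, ∃ c : H, conj φ M c ≤ conj φ M a ⊓ conj φ M b)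
    (hcover : ∀ n : N, ∃ a ∈ HPlus φ M, n ∈ conj φ M a⁻¹) (a : H)
    (F : ConvAlgebra (action φ M)) : theta ρ V a (star F) = star (theta ρ V a F) := by
  induction F using ConvAlgebra.induction with
  | zero => simp
  | add F G hF hG => rw [map_add, star_add, map_add, star_add, hF, hG]
  | single g f =>
    rw [ConvAlgebra.star_single, theta_single, theta_single, star_mul, hE.star_V hfilter,
      ← map_star, hE.V_mul_rho h hfilter hcover, ← ConvAlgebra.act_mul, ← map_star (action φ M a),
      ← ConvAlgebra.act_mul, mul_comm a]

/-- The defect `ρ(χ_{gMg⁻¹})` from `V_mul_V` is rewritten as `ρ(α_a(χ_{a⁻¹gMg⁻¹a}))`, so that it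
becomes a cut-off inside `α_a` which disappears for large `a`. -/
theorem theta_single_mul_theta_single (hE : IsExtension S P ρ V) (h : IsSPFamily S P)
    (hfilter : ∀ a b : H, ∃ c : H, conj φ M c ≤ conj φ M a ⊓ conj φ M b)
    (hcover : ∀ n : N, ∃ a ∈ HPlus φ M, n ∈ conj φ M a⁻¹) (a g k : H) (f f' : D φ M) :
    theta ρ V a (.single (action φ M) g f) * theta ρ V a (.single (action φ M) k f') =
      ρ (action φ M a (f * action φ M g f' * cosetD φ M (a⁻¹ * g) 1)) * V (g * k) := by
  rw [theta_single, theta_single, mul_assoc, ← mul_assoc (V g), hE.V_mul_rho h hfilter hcover,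
    mul_assoc (ρ _), hE.V_mul_V h hfilter hcover, map_mul (action φ M a), map_mul (action φ M a),
    action_cosetD_one, mul_inv_cancel_left, map_mul ρ, map_mul ρ, ← ConvAlgebra.act_mul,
    ← ConvAlgebra.act_mul, mul_comm g a]
  simp only [mul_assoc]

theorem tendsto_theta_mul (hE : IsExtension S P ρ V) (h : IsSPFamily S P)
    (hfilter : ∀ a b : H, ∃ c : H, conj φ M c ≤ conj φ M a ⊓ conj φ M b)
    (hcover : ∀ n : N, ∃ a ∈ HPlus φ M, n ∈ conj φ M a⁻¹) (F G : ConvAlgebra (action φ M)) :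
    Tendsto (fun a : HPlus φ M => theta ρ V a F * theta ρ V a G - theta ρ V a (F * G))
      (tails φ M) (𝓝 0) := by
  induction F using ConvAlgebra.induction with
  | zero => simp
  | add F F' hF hF' =>
    rw [← add_zero (0 : B)]
    refine (hF.add hF').congr fun a => ?_
    rw [map_add, add_mul, add_mul, map_add]
    abel
  | single g f =>
    induction G using ConvAlgebra.induction with
    | zero => simp
    | add G G' hG hG' =>
      rw [← add_zero (0 : B)]
      refine (hG.add hG').congr fun a => ?_
      rw [map_add, mul_add, mul_add, map_add]
      abel
    | single k f' =>
      have hlim := tendsto_mul_cosetD hfilter hcover g (f * action φ M g f')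
      refine squeeze_zero_norm (fun a => ?_) (tendsto_iff_norm_sub_tendsto_zero.1 hlim)
      rw [hE.theta_single_mul_theta_single h hfilter hcover, ConvAlgebra.single_mul_single,
        theta_single, ← sub_mul, ← map_sub, ← map_sub]
      refine (norm_mul_le _ _).trans
        ((mul_le_of_le_one_right (norm_nonneg _) (hE.norm_V_le h hfilter _)).trans ?_)
      exact (NonUnitalStarAlgHom.norm_apply_le _ _).trans (norm_action_le _ _)

/-- The limit of `‖θ_a(F)‖` along an ultrafilter is a C*-seminorm, which dominates `‖θ_1(F)‖`. -/
theorem norm_theta_one_le (hE : IsExtension S P ρ V) (h : IsSPFamily S P)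
    (hfilter : ∀ a b : H, ∃ c : H, conj φ M c ≤ conj φ M a ⊓ conj φ M b)
    (hcover : ∀ n : N, ∃ a ∈ HPlus φ M, n ∈ conj φ M a⁻¹) (F : ConvAlgebra (action φ M)) :
    ‖theta ρ V 1 F‖ ≤ ‖F‖ := by
  have hbound := norm_theta_le (ρ := ρ) (hE.norm_V_le h hfilter)
  -- Convergence of `‖θ_a(F)‖` along `tails` is not known. Along an ultrafilter it is automatic,
  -- because the values lie in the compact interval from `0` to the `ℓ¹`-norm.
  let U : Ultrafilter (HPlus φ M) := Ultrafilter.of (tails φ M)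
  have hU : (U : Filter (HPlus φ M)) ≤ tails φ M := Ultrafilter.of_le _
  have hex : ∀ F : ConvAlgebra (action φ M), ∃ r : ℝ,
      Tendsto (fun a : HPlus φ M => ‖theta ρ V a F‖) U (𝓝 r) := fun F => by
    obtain ⟨r, -, hr⟩ := (isCompact_Icc (a := (0 : ℝ)) (b := F.l1Norm)).ultrafilter_le_nhds
      (U.map fun a : HPlus φ M => ‖theta ρ V a F‖)
      (le_principal_iff.2 (mem_map.2 (univ_mem' fun a => ⟨norm_nonneg _, hbound a F⟩)))
    exact ⟨r, hr⟩
  choose q hq using hex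
  let Q : Seminorm ℂ (ConvAlgebra (action φ M)) := Seminorm.of q
    (fun F G => le_of_tendsto_of_tendsto' (hq _) ((hq F).add (hq G)) fun a => by
      rw [map_add]; exact norm_add_le _ _)
    (fun r F => tendsto_nhds_unique (hq _) (((hq F).const_mul ‖r‖).congr fun a => by
      rw [map_smul, norm_smul]))
  have hQ : ConvAlgebra.IsCStarSeminorm Q :=
    { mul_le := fun F G => by
        have h0 := ((hE.tendsto_theta_mul h hfilter hcover F G).mono_left hU).norm
        rw [norm_zero] at h0
        have h1 := ((hq F).mul (hq G)).add h0
        rw [add_zero] at h1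
        refine le_of_tendsto_of_tendsto' (hq _) h1 fun a => ?_
        rw [add_comm]
        refine (norm_le_norm_sub_add _ (theta ρ V a F * theta ρ V a G)).trans ?_
        rw [norm_sub_rev]
        exact add_le_add_right (norm_mul_le _ _) _
      star_mul_self := fun F => by
        have h0 := ((hE.tendsto_theta_mul h hfilter hcover (star F) F).mono_left hU)
        -- Each `θ_a` preserves adjoints exactly, so `‖θ_a(F^*) θ_a(F)‖ = ‖θ_a(F)‖²`, and this
        -- differs from `‖θ_a(F^* F)‖` by a null sequence along `U`.
        have h1 : Tendsto (fun a : HPlus φ M => ‖theta ρ V a (star F) * theta ρ V a F‖ -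
            ‖theta ρ V a (star F * F)‖) U (𝓝 0) :=
          squeeze_zero_norm (fun a => abs_norm_sub_norm_le _ _) (by simpa using h0.norm)
        have h2 := h1.add (hq (star F * F))
        refine (zero_add (q (star F * F))).symm.trans
          (tendsto_nhds_unique h2 (((hq F).pow 2).congr fun a => ?_))
        rw [sub_add_cancel, hE.theta_star h hfilter hcover, CStarRing.norm_star_mul_self, sq]
      le_l1Norm := fun F => le_of_tendsto (hq F) (Eventually.of_forall fun a => hbound a F) }
  refine le_trans ?_ (ConvAlgebra.le_norm ⟨Q, hQ⟩ F)
  refine ge_of_tendsto (hq F) (Eventually.of_forall fun a => ?_)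
  -- `θ_1(F)` is the compression of every `θ_a(F)` by the contraction `S_a`, so its norm is at most
  -- each `‖θ_a(F)‖`, hence at most the limit.
  rw [← hE.star_S_mul_theta_mul_S h hfilter hcover a F]
  refine (norm_mul_le _ _).trans ((mul_le_of_le_one_right (norm_nonneg _) (h.norm_S_le a)).trans ?_)
  refine (norm_mul_le _ _).trans (mul_le_of_le_one_left (norm_nonneg _) ?_)
  rw [norm_star]
  exact h.norm_S_le a

end IsExtension

end Theta

end AxPlusB

/-! ### Density and extension for the full crossed product. -/

theorem UniformSpace.Completion.exists_extension_of_norm_le {E F : Type*}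
    [SeminormedAddCommGroup E] [NormedSpace ℂ E] [NormedAddCommGroup F] [NormedSpace ℂ F]
    [CompleteSpace F] (θ : E →ₗ[ℂ] F) (hθ : ∀ x, ‖θ x‖ ≤ ‖x‖) :
    ∃ Θ : UniformSpace.Completion E →L[ℂ] F, ∀ x : E, Θ x = θ x := by
  let θ' : E →L[ℂ] F := θ.mkContinuous 1 fun x => by rw [one_mul]; exact hθ x
  exact ⟨θ'.extend (UniformSpace.Completion.toComplL (𝕜 := ℂ) (E := E)), fun x =>
    θ'.extend_eq UniformSpace.Completion.denseRange_coe
      (UniformSpace.Completion.isUniformInducing_coe E) x⟩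

namespace FullCrossedProduct

variable {H A : Type*} [Group H] [NonUnitalCStarAlgebra A] {α : H →* (A →⋆ₙₐ[ℂ] A)}

/-- A closed additive property which holds for all `i_A(a) i_H(h)` holds on the crossed product. -/
theorem induction {P : FullCrossedProduct α → Prop} (hcl : IsClosed {x | P x}) (zero : P 0)
    (add : ∀ x y, P x → P y → P (x + y)) (of : ∀ h a, P (of α h a)) (x : FullCrossedProduct α) :
    P x := by
  refine UniformSpace.Completion.induction_on (α := ConvAlgebra α) x hcl fun F => ?_
  induction F using ConvAlgebra.induction with
  | zero => exact zero
  | add F G hF hG =>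
    have := add _ _ hF hG
    exact (UniformSpace.Completion.coe_add F G).symm ▸ this
  | single h a => exact of h a

theorem of_add (h : H) (a b : A) : of α h (a + b) = of α h a + of α h b := by
  rw [of, ConvAlgebra.single_add]
  exact UniformSpace.Completion.coe_add _ _

theorem of_smul (r : ℂ) (h : H) (a : A) : of α h (r • a) = r • of α h a := by
  rw [of, ← ConvAlgebra.smul_single]
  exact UniformSpace.Completion.coe_smul _ _

theorem of_zero (h : H) : of α h (0 : A) = 0 := by
  have := of_smul (α := α) 0 h 0
  rwa [zero_smul, zero_smul] at this

/-- A linear map on `C_c(H, A)` which is contractive for the universal norm extends to the crossed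
product. -/
theorem exists_extension {E : Type*} [NormedAddCommGroup E] [NormedSpace ℂ E] [CompleteSpace E]
    (θ : ConvAlgebra α →ₗ[ℂ] E) (hθ : ∀ F, ‖θ F‖ ≤ ‖F‖) :
    ∃ Θ : FullCrossedProduct α →L[ℂ] E, ∀ h a, Θ (of α h a) = θ (.single α h a) := by
  obtain ⟨Θ, hΘ⟩ := UniformSpace.Completion.exists_extension_of_norm_le θ hθ
  exact ⟨Θ, fun h a => hΘ _⟩

end FullCrossedProduct

/-! ### The concrete SP-family in `pCp` and its universal property. -/

namespace AxPlusB

open scoped Pointwise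
open Filter Topology

section Corner

variable {N H : Type*} [Group N] [CommGroup H] {φ : H →* MulAut N} {M : Subgroup N}

/-- The inclusion of `D` into `C`. -/
noncomputable def ofOne : D φ M →⋆ₙₐ[ℂ] C φ M where
  toFun f := .of (action φ M) 1 f
  map_smul' r f := FullCrossedProduct.of_smul r 1 f
  map_zero' := FullCrossedProduct.of_zero 1
  map_add' f g := FullCrossedProduct.of_add 1 f g
  map_mul' f g := (of_one_mul_of_one φ M f g).symm
  map_star' f := by
    rw [FullCrossedProduct.star_of, inv_one, map_one]; rfl

/-- The inclusion of `p C p` into `C`. -/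
noncomputable def inclusion : PCP φ M →⋆ₙₐ[ℂ] C φ M where
  toFun x := x.1
  map_smul' _ _ := rfl
  map_zero' := rfl
  map_add' _ _ := rfl
  map_mul' _ _ := rfl
  map_star' _ := rfl

theorem inclusion_injective : Function.Injective (inclusion (φ := φ) (M := M)) :=
  Subtype.val_injective

/-- The compression `x ↦ p x p` of `C` to `p C p`. -/
noncomputable def compression (x : C φ M) : PCP φ M := ⟨p φ M * x * p φ M, x, rfl⟩

theorem p_mul_mul_p (x : PCP φ M) : p φ M * x.1 * p φ M = x.1 :=
  (mem_cornerSubalgebra (isStarProjection_p φ M)).1 x.2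

theorem mul_p (x : PCP φ M) : x.1 * p φ M = x.1 := by
  rw [← p_mul_mul_p x, mul_assoc, (isStarProjection_p φ M).isIdempotentElem.eq]

theorem compression_val (x : PCP φ M) : compression x.1 = x :=
  Subtype.ext (p_mul_mul_p x)

theorem cosetD_mul_of_le {g h : H} (hle : conj φ M g ≤ conj φ M h) :
    cosetD φ M g 1 * cosetD φ M h 1 = cosetD φ M g 1 :=
  Subtype.ext (charFun_mul (by rw [one_smul, one_smul]; exact hle))

theorem cosetD_one_mul (a : HPlus φ M) (m : M) :
    cosetD φ M 1 1 * cosetD φ M (a : H) (m : N) = cosetD φ M (a : H) (m : N) := by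
  rw [D.mul_comm']
  refine Subtype.ext (charFun_mul ?_)
  rw [one_smul, conj_one]
  rintro _ ⟨x, hx, rfl⟩
  exact M.mul_mem m.2 (a.2 hx)

theorem cosetD_mul_self (h : H) (n : N) :
    cosetD φ M h n * cosetD φ M h n = cosetD φ M h n :=
  Subtype.ext (charFun_mul subset_rfl)

theorem star_cosetD (h : H) (n : N) : star (cosetD φ M h n) = cosetD φ M h n :=
  Subtype.ext (star_charFun _)

/-- The two cut-offs by `χ_M` around `a` combine to `χ_M χ_{aMa⁻¹}`, and `aMa⁻¹ ⊆ M`. In this normal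
form the relations of the family become computations with cosets. -/
theorem val_sElem (a : HPlus φ M) :
    (sElem a).1 = .of (action φ M) (a : H) (cosetD φ M (a : H) 1) := by
  change p φ M * .of (action φ M) (a : H) (cosetD φ M 1 1) * p φ M = _
  rw [p, FullCrossedProduct.of_mul_of, FullCrossedProduct.of_mul_of, map_one, one_mul, mul_one,
    action_cosetD_one, mul_one]
  congr 1
  change cosetD φ M 1 1 * cosetD φ M 1 1 * _ = _
  rw [cosetD_mul_self]
  exact cosetD_one_mul a 1

theorem star_val_sElem (a : HPlus φ M) :
    star (sElem a).1 = .of (action φ M) (a : H)⁻¹ (cosetD φ M 1 1) := by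
  rw [val_sElem, FullCrossedProduct.star_of, star_cosetD, action_cosetD_one, inv_mul_cancel]

/-- Evaluation of an element of `D` at a point. -/
noncomputable def D.eval (n : N) : D φ M →+ ℂ where
  toFun f := f.1 n
  map_zero' := rfl
  map_add' _ _ := rfl

/-- The coset `k aMa⁻¹` is the disjoint union of the cosets `k(ama⁻¹) abM(ab)⁻¹`, where `m` runs
over representatives of `M/bMb⁻¹`. Transport by `a⁻¹` after translation by `k⁻¹` reduces this to the
coset decomposition of `M`. -/
theorem cosetD_eq_sum (a b : HPlus φ M) (k : M) (T : Finset M)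
    (hT : Subgroup.IsComplement (T : Set M) ((conj φ M (b : H)).subgroupOf M : Set M)) :
    cosetD φ M (a : H) (k : N) =
      ∑ m ∈ T, cosetD φ M ((a * b : HPlus φ M) : H) ((k * conjM a m : M) : N) := by
  classical
  refine D.ext fun n => ?_
  change cosetFun φ M _ _ n = D.eval n _
  rw [map_sum]
  change _ = ∑ m ∈ T, cosetFun φ M ((a : H) * b) (k * φ a m) n
  have hiff : ∀ m : M, (k * φ a m : N)⁻¹ * n ∈ conj φ M ((a : H) * b) ↔
      (m : N)⁻¹ * φ (a : H)⁻¹ ((k : N)⁻¹ * n) ∈ conj φ M (b : H) := fun m => by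
    rw [← inv_mul_cancel_left (a : H) (b : H), ← apply_mem_conj, inv_mul_cancel_left, map_mul,
      map_inv (φ a), map_inv φ, MulAut.apply_inv_self, mul_inv_rev, mul_assoc]
  by_cases hn : (k : N)⁻¹ * n ∈ conj φ M (a : H)
  · rw [cosetFun_apply_of_mem hn]
    obtain ⟨⟨m, hm⟩, hmem, huniq⟩ :=
      Subgroup.isComplement_iff_existsUnique_inv_mul_mem.1 hT ⟨_, mem_conj.1 hn⟩
    rw [Finset.sum_eq_single m]
    · exact (cosetFun_apply_of_mem ((hiff m).2 hmem)).symm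
    · intro m' hm' hne
      refine cosetFun_apply_of_notMem fun h' => hne ?_
      exact congrArg Subtype.val (huniq ⟨m', hm'⟩ ((hiff m').1 h'))
    · exact fun h' => absurd hm h'
  · rw [cosetFun_apply_of_notMem hn]
    refine (Finset.sum_eq_zero fun m _ => cosetFun_apply_of_notMem fun h' => hn ?_).symm
    rw [mem_conj]
    have h1 := M.mul_mem m.2 (b.2 ((hiff m).1 h'))
    rwa [mul_inv_cancel_left] at h1

theorem isSPFamily_sElem_pElem :
    IsSPFamily (φ := φ) (M := M) (B := PCP φ M) sElem pElem where
  isometry a := by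
    refine Subtype.ext ?_
    change star (sElem a).1 * (sElem a).1 = p φ M
    rw [star_val_sElem, val_sElem, FullCrossedProduct.of_mul_of, action_cosetD_one, inv_mul_cancel,
      cosetD_mul_self, p]
  projection a m :=
    { isIdempotentElem := Subtype.ext (by
        change FullCrossedProduct.of (action φ M) 1 _ * FullCrossedProduct.of (action φ M) 1 _ = _
        rw [of_one_mul_of_one, cosetD_mul_self]; rfl)
      isSelfAdjoint := Subtype.ext (by
        change star (ofOne (cosetD φ M (a : H) (m : N))) = ofOne _
        rw [← map_star, star_cosetD]) }
  s_mul a b := by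
    refine Subtype.ext ?_
    change (sElem a).1 * (sElem b).1 = (sElem (a * b)).1
    rw [val_sElem, val_sElem, val_sElem, FullCrossedProduct.of_mul_of, action_cosetD_one,
      D.mul_comm', cosetD_mul_of_le (conj_mul_le _ b)]
    rfl
  p_one := rfl
  s_p a b m := by
    refine Subtype.ext ?_
    change (sElem a).1 * FullCrossedProduct.of (action φ M) 1 (cosetD φ M (b : H) (m : N)) *
      star (sElem a).1 = FullCrossedProduct.of (action φ M) 1 (cosetD φ M (a * b : H) (φ a m))
    have h1 : action φ M a (cosetD φ M 1 1 * cosetD φ M (b : H) (m : N)) =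
        action φ M a (cosetD φ M (b : H) (m : N)) := by rw [cosetD_one_mul]
    rw [map_mul, action_cosetD_one, mul_one, action_cosetD] at h1
    rw [star_val_sElem, val_sElem, FullCrossedProduct.of_mul_of, FullCrossedProduct.of_mul_of,
      action_cosetD, mul_one, action_cosetD_one, mul_one, mul_inv_cancel, h1, D.mul_comm', h1]
  p_sum a b k T hT := by
    refine inclusion_injective ?_
    rw [map_sum]
    change ofOne (cosetD φ M (a : H) (k : N)) = ∑ m ∈ T, ofOne (cosetD φ M _ _)
    rw [← map_sum, cosetD_eq_sum a b k T hT]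

theorem compression_of_one (f : D φ M) :
    (compression (.of (action φ M) 1 f)).1 = ofOne (cosetD φ M 1 1 * f) := by
  change ofOne (cosetD φ M 1 1) * ofOne f * ofOne (cosetD φ M 1 1) = _
  rw [← map_mul, ← map_mul, mul_assoc, D.mul_comm' f, ← mul_assoc, cosetD_mul_self]

/-- The compression of `i_D(f) i_H(g)` is the product of that of `i_D(f)` with `s_c^* s_b`, where
`g = c⁻¹ b`. -/
theorem compression_of {g : H} {b c : HPlus φ M} (hg : (c : H) * g = b) (f : D φ M) :
    compression (.of (action φ M) g f) =
      compression (.of (action φ M) 1 f) * (star (sElem c) * sElem b) := by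
  refine Subtype.ext ?_
  change p φ M * .of (action φ M) g f * p φ M =
    (compression (.of (action φ M) 1 f)).1 * (star (sElem c).1 * (sElem b).1)
  rw [compression_of_one, star_val_sElem, val_sElem, p]
  change _ = FullCrossedProduct.of (action φ M) 1 _ * _
  rw [FullCrossedProduct.of_mul_of, FullCrossedProduct.of_mul_of, FullCrossedProduct.of_mul_of,
    FullCrossedProduct.of_mul_of, action_cosetD_one, action_cosetD_one, mul_one, one_mul, one_mul,
    ← hg, inv_mul_cancel_left, map_one]
  congr 1
  change cosetD φ M 1 1 * f * _ = cosetD φ M 1 1 * f * (cosetD φ M 1 1 * _)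
  rw [← mul_assoc, mul_assoc (cosetD φ M 1 1) f (cosetD φ M 1 1), D.mul_comm' f, ← mul_assoc,
    cosetD_mul_self]

theorem compression_of_one_mul_pElem (c : HPlus φ M) (f : D φ M)
    (hf : ∀ n, ∀ x ∈ conj φ M (c : H), f.1 (n * x) = f.1 n) (k : M) :
    compression (.of (action φ M) 1 f) * pElem c k = f.1 k • pElem c k := by
  refine Subtype.ext ?_
  change (compression (.of (action φ M) 1 f)).1 * ofOne (cosetD φ M (c : H) (k : N)) =
    f.1 k • ofOne (cosetD φ M (c : H) (k : N))
  rw [compression_of_one, ← map_mul, ← map_smul, D.mul_comm' _ f, mul_assoc, cosetD_one_mul]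
  congr 1
  refine D.ext fun n => ?_
  change f.1 n * cosetFun φ M c k n = f.1 k * cosetFun φ M c k n
  by_cases hn : (k : N)⁻¹ * n ∈ conj φ M (c : H)
  · rw [← hf k _ hn, mul_inv_cancel_left]
  · rw [cosetFun_apply_of_notMem hn, mul_zero, mul_zero]

variable {B : Type*} [CStarAlgebra B] [∀ c : HPlus φ M, Fintype (Cosets c)]

/-- Agreement spreads from the generators to compressions of tame functions, to compressions of all
of `D` by continuity, and then to compressions of all `i_D(f) i_H(g)` through `compression_of`;
these span a dense subspace of `pCp`. -/
theorem hom_ext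
    (hfilter : ∀ a b : H, ∃ c : H, conj φ M c ≤ conj φ M a ⊓ conj φ M b)
    (hcover : ∀ n : N, ∃ a ∈ HPlus φ M, n ∈ conj φ M a⁻¹) (Φ Ψ : PCP φ M →⋆ₙₐ[ℂ] B)
    (hs : ∀ a, Φ (sElem a) = Ψ (sElem a)) (hp : ∀ a m, Φ (pElem a m) = Ψ (pElem a m)) :
    Φ = Ψ := by
  have hcomp : Continuous (compression (φ := φ) (M := M)) :=
    Continuous.subtype_mk (by fun_prop) _
  have hone : ∀ f : D φ M, Φ (compression (.of (action φ M) 1 f)) =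
      Ψ (compression (.of (action φ M) 1 f)) := by
    refine D.induction_tame hfilter hcover ?_ ?_
    · have hc : Continuous fun f : D φ M => compression (.of (action φ M) 1 f) :=
        hcomp.comp (continuous_starHom (ofOne (φ := φ) (M := M)))
      exact isClosed_eq ((continuous_starHom Φ).comp hc) ((continuous_starHom Ψ).comp hc)
    · intro c f hf
      -- The unit `p` is the sum of the `p(c,m)` over `M/cMc⁻¹`, and `p f p` is a scalar on each of
      -- them, so it is a linear combination of the `p(c,m)`.
      rw [isSPFamily_sElem_pElem.mul_eq_sum c (compression _), map_sum, map_sum]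
      refine Finset.sum_congr rfl fun x _ => ?_
      rw [compression_of_one_mul_pElem c f hf.invariant, map_smul, map_smul, hp]
  have hall : ∀ x : C φ M, Φ (compression x) = Ψ (compression x) := by
    have hadd : ∀ x y : C φ M, compression (x + y) = compression x + compression y := fun x y =>
      Subtype.ext (by
        change p φ M * (x + y) * p φ M = p φ M * x * p φ M + p φ M * y * p φ M
        rw [mul_add, add_mul])
    have hzero : compression (0 : C φ M) = 0 := Subtype.ext (by
      change p φ M * 0 * p φ M = 0
      rw [mul_zero, zero_mul])
    refine FullCrossedProduct.induction ?_ ?_ ?_ ?_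
    · exact isClosed_eq ((continuous_starHom Φ).comp hcomp) ((continuous_starHom Ψ).comp hcomp)
    · rw [hzero, map_zero, map_zero]
    · intro x y hx hy
      rw [hadd, map_add, map_add, hx, hy]
    · intro g f
      obtain ⟨b, c, hbc⟩ := exists_mul_mem_HPlus hfilter g
      rw [compression_of hbc, map_mul, map_mul, map_mul, map_mul, map_star, map_star, hone, hs, hs]
  refine NonUnitalStarAlgHom.ext fun x => ?_
  rw [← compression_val x]
  exact hall x.1

theorem IsSPFamily.exists_hom {S : HPlus φ M → B} {P : HPlus φ M → M → B} (h : IsSPFamily S P)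
    (hfilter : ∀ a b : H, ∃ c : H, conj φ M c ≤ conj φ M a ⊓ conj φ M b)
    (hcover : ∀ n : N, ∃ a ∈ HPlus φ M, n ∈ conj φ M a⁻¹) :
    ∃ Φ : PCP φ M →⋆ₙₐ[ℂ] B, (∀ a, Φ (sElem a) = S a) ∧ ∀ a m, Φ (pElem a m) = P a m := by
  obtain ⟨ρ, hρ⟩ := h.exists_rho hfilter hcover
  obtain ⟨V, hV⟩ := h.exists_V hfilter
  have hE : IsExtension S P ρ V := ⟨hρ, hV⟩
  obtain ⟨Θ, hΘ⟩ := FullCrossedProduct.exists_extension (theta ρ V 1)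
    (hE.norm_theta_one_le h hfilter hcover)
  have hof : ∀ g f, Θ (.of (action φ M) g f) = ρ f * V g := fun g f => by
    rw [hΘ, theta_one_single]
  have hstar : ∀ x : C φ M, Θ (star x) = star (Θ x) := by
    refine FullCrossedProduct.induction ?_ ?_ ?_ ?_
    · exact isClosed_eq (Θ.continuous.comp continuous_star) (continuous_star.comp Θ.continuous)
    · rw [star_zero, map_zero, star_zero]
    · intro x y hx hy
      rw [star_add, map_add, map_add, star_add, hx, hy]
    · intro g f
      rw [FullCrossedProduct.star_of, hΘ, hΘ, ← ConvAlgebra.star_single,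
        hE.theta_star h hfilter hcover]
  -- At `a = e` the defect is `χ_{gMg⁻¹} = α_g(χ_M)`, exactly what arises from placing `p` between
  -- the two factors. Linearity and continuity in each variable then give `Θ(x)Θ(y) = Θ(x p y)`
  -- everywhere.
  have hsingle : ∀ g f k f', Θ (.of (action φ M) g f) * Θ (.of (action φ M) k f') =
      Θ (.of (action φ M) g f * p φ M * .of (action φ M) k f') := fun g f k f' => by
    rw [p, FullCrossedProduct.of_mul_of, FullCrossedProduct.of_mul_of, hof (g * 1 * k), hΘ, hΘ,
      hE.theta_single_mul_theta_single h hfilter hcover, action_cosetD_one, inv_one, one_mul,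
      mul_one, map_one, mul_assoc, D.mul_comm' (action φ M g f'), ← mul_assoc]
    rfl
  have hright : ∀ g f (y : C φ M), Θ (.of (action φ M) g f) * Θ y =
      Θ (.of (action φ M) g f * p φ M * y) := fun g f => by
    refine FullCrossedProduct.induction ?_ ?_ ?_ (hsingle g f)
    · exact isClosed_eq (continuous_const.mul Θ.continuous)
        (Θ.continuous.comp (continuous_const.mul continuous_id))
    · rw [mul_zero, map_zero, mul_zero]
    · intro y y' hy hy'
      rw [mul_add, map_add, map_add, mul_add, hy, hy']
  have hmul : ∀ y x : C φ M, Θ x * Θ y = Θ (x * p φ M * y) := fun y => by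
    refine FullCrossedProduct.induction ?_ ?_ ?_ fun g f => hright g f y
    · exact isClosed_eq (Θ.continuous.mul continuous_const)
        (Θ.continuous.comp ((continuous_id.mul continuous_const).mul continuous_const))
    · rw [zero_mul, zero_mul, map_zero, zero_mul]
    · intro x x' hx hx'
      rw [add_mul, add_mul, map_add, map_add, add_mul, hx, hx']
  -- On `pCp` the inserted `p` is absorbed, so the restriction of `Θ` is multiplicative.
  refine ⟨⟨⟨⟨⟨fun x => Θ x.1, fun r x => ?_⟩, ?_, fun x y => ?_⟩, fun x y => ?_⟩, fun x => ?_⟩,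
    fun a => ?_, fun a m => ?_⟩
  · exact Θ.map_smul r x.1
  · exact Θ.map_zero
  · exact Θ.map_add x.1 y.1
  · change Θ (x.1 * y.1) = Θ x.1 * Θ y.1
    rw [hmul, mul_p]
  · exact hstar x.1
  · change Θ (sElem a).1 = S a
    rw [val_sElem, hof, hE.rho_cosetD_one h, hE.V_coe h, mul_assoc, h.isometry, mul_one]
  · change Θ (.of (action φ M) 1 (cosetD φ M (a : H) (m : N))) = P a m
    have h1 : V 1 = 1 := by
      rw [hV 1 1 1 (mul_one _), h.isometry]
    rw [hof, hE.rho_cosetD h, h1, mul_one]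

end Corner

end AxPlusB

/-- `N ⋊ H` is given by an action `φ` of `H` on `N` by automorphisms, so that `a n a⁻¹ = φ a n`, and
`AxPlusB.conj φ M a = a M a⁻¹`. -/
theorem mainTheorem4 {N H : Type*} [Group N] [CommGroup H] (φ : H →* MulAut N)
    (M : Subgroup N) [M.Normal] (hM : M ≠ ⊥)
    (hfilter : ∀ a b : H, ∃ c : H, AxPlusB.conj φ M c ≤ AxPlusB.conj φ M a ⊓ AxPlusB.conj φ M b)
    (hsep : ⨅ a : H, AxPlusB.conj φ M a = ⊥)
    (hfin : ∀ a b : H, AxPlusB.conj φ M b ≤ AxPlusB.conj φ M a →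
      Finite (AxPlusB.conj φ M a ⧸ (AxPlusB.conj φ M b).subgroupOf (AxPlusB.conj φ M a)))
    (hcover : ∀ n : N, ∃ a ∈ AxPlusB.HPlus φ M, n ∈ AxPlusB.conj φ M a⁻¹) :
    AxPlusB.IsSPFamily (φ := φ) (M := M) AxPlusB.sElem AxPlusB.pElem ∧
    ∀ (B : Type*) [CStarAlgebra B] (S : AxPlusB.HPlus φ M → B) (P : AxPlusB.HPlus φ M → M → B),
      AxPlusB.IsSPFamily S P →
      ∃! Φ : AxPlusB.PCP φ M →⋆ₙₐ[ℂ] B,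
        (∀ a, Φ (AxPlusB.sElem a) = S a) ∧ ∀ a m, Φ (AxPlusB.pElem a m) = P a m := by
  have hcosets : ∀ c : AxPlusB.HPlus φ M, Nonempty (Fintype (AxPlusB.Cosets c)) := fun c => by
    -- Finiteness is available for quotients of conjugates of `M`, so `M` is first treated as its
    -- conjugate by `1`; the relative index can then be rewritten along `conj_one`.
    have hne : (AxPlusB.conj φ M (c : H)).relIndex (AxPlusB.conj φ M 1) ≠ 0 := by
      have := hfin 1 c (by rw [AxPlusB.conj_one]; exact c.2)
      exact (Subgroup.finiteIndex_of_finite_quotient).index_ne_zero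
    rw [AxPlusB.conj_one] at hne
    exact ⟨Subgroup.fintypeOfIndexNeZero hne⟩
  let _ : ∀ c : AxPlusB.HPlus φ M, Fintype (AxPlusB.Cosets c) := fun c => (hcosets c).some
  refine ⟨AxPlusB.isSPFamily_sElem_pElem, fun B _ S P h => ?_⟩
  obtain ⟨Φ, hs, hp⟩ := h.exists_hom hfilter hcover
  exact ⟨Φ, ⟨hs, hp⟩, fun Ψ hΨ => AxPlusB.hom_ext hfilter hcover Ψ Φ
    (fun a => by rw [hΨ.1, hs]) fun a m => by rw [hΨ.2, hp]⟩
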